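/- **Conventions.** For $f,g:\mathbb N\to\mathbb N$ write $f\le_{ct}g$ if $\exists c\,\forall n\; f(n)\le g(n)+c$; $f=_{ct}g$ if $f\le_{ct}g$ and $g\le_{ct}f$; and $f<_{ct}g$ if $f\le_{ct}g$ and $\forall c\,\exists n\; f(n)<g(n)-c$. Programs are words $p\in\{0,1\}^*$, of length $|p|$. A language is a map $U:\{0,1\}^*\to E$; for a partial function $\rho$ from $E$ to $\mathbb N$ or $\mathbb Z$ put $K_{\rho,U}(n)=\min\{|p| : \rho(U(p))=n\}$. *Classical complexities.* $K(n)$ is the shortest length of a program which halts and outputs $n$, for a partial recursive language $\{0,1\}^*\to\mathbb N$. $K^\infty(n)$ is the shortest length of a possibly non-halting program whose total output is $n$ in unary: a language is here a recursive function telling whether program $p$ outputs a symbol $1$ at step $t$, and $p$ outputs $n$ if this happens at exactly $n$ steps. $K'$ and $K'^\infty$ are defined in the same way with the oracle $\emptyset'$ (the halting problem). In all four cases the language is optimal, i.e. its complexity is $\le_{ct}$ that of every other language of the same kind. *Strongly universal enumerations.* For the other complexities, $U$ is strongly universal: it is an effective map $\{0,1\}^*\to\mathcal E$, and for some recursive $\mathtt{comp}$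 the maps $p\mapsto U(\mathtt{comp}(e,p))$, $e\in\{0,1\}^*$, are exactly all the effective maps $\{0,1\}^*\to\mathcal E$, with $|\mathtt{comp}(e,p)|\le|p|+c(e)$. The classes $\mathcal E$ and representations $\rho$ are as follows; $PR(X\to Y)$ denotes the set of partial recursive functions, and $\varphi_e$ the function in $PR(\mathbb N\to\mathbb N)$ with Gödel number $e$. * *Church.* $\mathcal E$ is the set of effective operations $F:PR(\mathbb N\to\mathbb N)\to PR(\mathbb N\to\mathbb N)$, i.e. those for which some recursive $h$ satisfies $F(\varphi_e)=\varphi_{h(e)}$ for all $e$. $Church^{\mathbb N}(F)=n$ iff $F(f)=f^{(n)}$ for all $f$, where $f^{(0)}=\mathrm{id}$ and $f^{(n+1)}=f^{(n)}\circ f$. * *$\mathbb Z$-Church.* For $n\ge1$ the negative iterate $It_{-n}(e)$ of (the function with Gödel number) $e$ has domain $\mathrm{Range}(\varphi_e^{(n)})$, and its value at $x$ is the $y$ for which the computation of $\varphi_e^{(n)}(y)$ is the first to halt with value $x$ among those of $\varphi_e^{(n)}(0),\varphi_e^{(n)}(1),\dots$ run in parallel; $It_n(e)=\varphi_e^{(n)}$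 for $n\ge0$. $\mathcal E$ is the set of operations $F$ on Gödel numbers induced by recursive functions $h$, $F(e)=\varphi_{h(e)}$ (the value may depend on the Gödel number $e$ and not only on $\varphi_e$), and $Church^{\mathbb Z}(F)=n$ iff $F(e)=It_n(e)$ for all $e$. The theorem also holds when $\mathcal E$ is, as for $Church^{\mathbb N}$, the set of effective operations on functions, with $Church^{\mathbb Z}(F)=n$ iff $F(\varphi_e)=It_n(e)$ for all $e$. * *Cardinal.* $\mathcal E=PR(\mathbb N\to\mathbb N)$; $card^{\mathbb N}(f)$ is the number of elements of $\mathrm{dom}\,f$ if this is finite, and undefined otherwise. * *$\mathbb Z$-cardinal.* $\mathcal E=PR(\mathbb N\to\mathbb N)^2$; $card^{\mathbb Z}(f,g)=card^{\mathbb N}(f)-card^{\mathbb N}(g)$ if both are defined, and undefined otherwise. * *Ordinal.* $\mathcal E=PR(\mathbb N^2\to\mathbb N)$; $ord(f)=n$ iff the quotient order of the preorder generated by $\mathrm{dom}\,f$ (its reflexive transitive closure) on the field of $\mathrm{dom}\,f$ (the set of integers that are a component of a pair in $\mathrm{dom}\,f$) is a finite total order of order type $n$. **Theorem.** Optimal,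 respectively strongly universal, languages exist in all these classes. For every choice of them the complexities take finite values on $\mathbb N$ and $$K^{\mathbb N}_{Church}=_{ct}K^{\mathbb Z}_{Church}\!\upharpoonright\!\mathbb N=_{ct}K,\qquad K^{\mathbb N}_{card}=_{ct}K^\infty,\qquad K^{\mathbb Z}_{card}\!\upharpoonright\!\mathbb N=_{ct}K',\qquad K_{ord}=_{ct}K'^\infty .$$ Consequently $$K^{\mathbb N}_{Church}=_{ct}K^{\mathbb Z}_{Church}\!\upharpoonright\!\mathbb N>_{ct}K^{\mathbb N}_{card}>_{ct}K^{\mathbb Z}_{card}\!\upharpoonright\!\mathbb N>_{ct}K_{ord}.$$ -/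

import Mathlib

noncomputable section

namespace KRep

open Nat.Partrec (Code)

/-! ### Comparison of complexity functions up to an additive constant -/

/-- `f ≤ g` up to an additive constant. -/
def LeCt (f g : ℕ → ℕ∞) : Prop := ∃ c : ℕ, ∀ n, f n ≤ g n + c

/-- `f = g` up to an additive constant. -/
def EqCt (f g : ℕ → ℕ∞) : Prop := LeCt f g ∧ LeCt g f

/-- `f < g` up to an additive constant: `f ≤ g` up to an additive constant and
`g - f` is unbounded. -/
def LtCt (f g : ℕ → ℕ∞) : Prop := LeCt f g ∧ ∀ c : ℕ, ∃ n, f n + c < g n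

/-! ### Programming languages and complexities

Programs are binary words.  A programming language with values in `E` is a map
`U : List Bool → E`.  A representation of the elements of `α` (which is `ℕ` or `ℤ`) by elements
of `E` is a partial function from `E` to `α`, given by its graph `ρ : E → α → Prop`. -/

/-- The least length of a program `p` such that `U p` represents `n`
(and `⊤` if there is no such program). -/
def complexity {E α : Type} (ρ : E → α → Prop) (U : List Bool → E) (n : α) : ℕ∞ :=
  ⨅ (p : List Bool) (_ : ρ (U p) n), (p.length : ℕ∞)

/-- `U` is an optimal language in the class `C` of languages: it belongs to `C`, and its
complexity is, up to an additive constant, least among all languages in `C`. -/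
def Optimal {E : Type} (C : (List Bool → E) → Prop) (ρ : E → ℕ → Prop)
    (U : List Bool → E) : Prop :=
  C U ∧ ∀ V, C V → LeCt (complexity ρ U) (complexity ρ V)

/-- `U` is strongly universal in the class `C` of languages: it belongs to `C`, and for some
recursive function `comp` the languages `p ↦ U (comp e p)` enumerate the class `C`, with
`|comp e p| ≤ |p| + c(e)`. -/
def StronglyUniversal {E : Type} (C : (List Bool → E) → Prop) (U : List Bool → E) : Prop :=
  C U ∧ ∃ comp : List Bool → List Bool → List Bool, Computable₂ comp ∧
    (Set.range fun (e p : List Bool) => U (comp e p)) = {V | C V} ∧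
    ∀ e, ∃ c : ℕ, ∀ p, (comp e p).length ≤ p.length + c

/-! ### Halting and infinite computations, with and without the oracle `∅'` -/

/-- The jump `∅'`: the halting problem for partial recursive functions. -/
def jump : Set ℕ := {n | ((Denumerable.ofNat Code n).eval n).Dom}

open Classical in
/-- The oracle `∅'`, as (the singleton of) its characteristic function. -/
def jumpOracle : Set (ℕ →. ℕ) := {fun n => Part.some (if n ∈ jump then 1 else 0)}

/-- Languages whose programs halt with an integer output, or do not halt. -/
def HaltLang (V : List Bool → Part ℕ) : Prop := Partrec V

/-- The same with oracle `∅'`. -/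
def HaltLangJump (V : List Bool → Part ℕ) : Prop := RecursiveIn jumpOracle V

/-- The program halts and outputs `n`. -/
def haltOut (v : Part ℕ) (n : ℕ) : Prop := n ∈ v

/-- Languages with possibly infinite computations and unary output: `V p t = true` means that
program `p` outputs a symbol `1` at step `t` of its computation.  (A program that halts
outputs nothing afterwards.) -/
def InfLang (V : List Bool → ℕ → Bool) : Prop := Computable₂ V

/-- The same with oracle `∅'`. -/
def InfLangJump (V : List Bool → ℕ → Bool) : Prop := ComputableIn₂ jumpOracle V

/-- The total output of the possibly infinite computation is the unary representation of `n`,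
i.e. the symbol `1` is output exactly `n` times. -/
def unaryOut (s : ℕ → Bool) (n : ℕ) : Prop := {t | s t = true}.encard = n

/-! ### Partial recursive functions and effective operations -/

/-- The set of partial recursive functions from `ℕ` to `ℕ`. -/
def PR : Type := {f : ℕ →. ℕ // Nat.Partrec f}

/-- The partial recursive function with Goedel number `c`. -/
def PR.ofCode (c : Code) : PR := ⟨c.eval, Code.exists_code.2 ⟨c, rfl⟩⟩

/-- Partial recursive maps from words to partial recursive functions `X → ℕ`. -/
def FunLang {X : Type} [Primcodable X] (V : List Bool → X →. ℕ) : Prop := Partrec₂ V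

/-- Partial recursive maps from words to pairs of partial recursive functions `ℕ → ℕ`. -/
def PairLang (V : List Bool → (ℕ →. ℕ) × (ℕ →. ℕ)) : Prop :=
  FunLang (fun p => (V p).1) ∧ FunLang (fun p => (V p).2)

/-- Effective maps from words to effective operations on partial recursive functions:
a recursive function `f` on words and Goedel numbers induces `V`.  In particular every `V p`
is an effective operation. -/
def EffLang (V : List Bool → PR → PR) : Prop :=
  ∃ f : List Bool → Code → Code, Computable₂ f ∧
    ∀ p c, V p (PR.ofCode c) = PR.ofCode (f p c)

/-- Effective maps from words to operations on Goedel numbers that are induced by recursive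
functions: as for `EffLang`, except that the value of an operation may depend on the given
Goedel number of its argument and not only on the function which that number denotes. -/
def CodeLang (V : List Bool → Code → PR) : Prop :=
  ∃ f : List Bool → Code → Code, Computable₂ f ∧ ∀ p c, V p c = PR.ofCode (f p c)

/-! ### Church's representations -/

/-- A Goedel number for the `n`-th iterate of the function with Goedel number `c`. -/
def iterCode (c : Code) : ℕ → Code
  | 0 => Code.id
  | n + 1 => Code.comp (iterCode c n) c

/-- The `n`-th iterate of a partial function: `f⁽⁰⁾ = id` and `f⁽ⁿ⁺¹⁾ = f⁽ⁿ⁾ ∘ f`. -/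
def iter (f : ℕ →. ℕ) : ℕ → ℕ →. ℕ
  | 0 => PFun.id ℕ
  | n + 1 => (iter f n).comp f

theorem eval_iterCode (c : Code) (n : ℕ) : (iterCode c n).eval = iter c.eval n := by
  induction n with
  | zero => funext x; simp [iterCode, iter]
  | succ n ih =>
    funext x
    simp only [iterCode, iter, Code.eval, ih, PFun.comp_apply]
    rfl

/-- The `n`-th negative iterate of the function with Goedel number `c`.  Its value at `x` is that
`y` such that the computation of the `n`-th iterate at `y` is the first one, among those at
`0, 1, 2, …` run in parallel, to halt with value `x` (the smaller argument comes first if two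
of them halt at the same stage).  It is undefined if `x` is not in the range of the `n`-th
iterate. -/
def negIter (c : Code) (n : ℕ) : ℕ →. ℕ := fun x =>
  Nat.rfindOpt fun s =>
    (List.range s).find? fun y => decide (Code.evaln s (iterCode c n) y = some x)

/-- The iterates, positive and negative, of the function with Goedel number `c`. -/
def iterZ (c : Code) : ℤ → ℕ →. ℕ
  | Int.ofNat n => iter c.eval n
  | Int.negSucc n => negIter c (n + 1)

/-- `Church^ℕ (F) = n`: the operation `F` is the `n`-th iterator. -/
def churchN (F : PR → PR) (n : ℕ) : Prop := ∀ f : PR, (F f).1 = iter f.1 n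

/-- `Church^ℤ (F) = z`, for operations on Goedel numbers. -/
def churchZCode (F : Code → PR) (z : ℤ) : Prop := ∀ c : Code, (F c).1 = iterZ c z

/-- `Church^ℤ (F) = z`, for operations on partial recursive functions. -/
def churchZ (F : PR → PR) (z : ℤ) : Prop := churchZCode (fun c => F (PR.ofCode c)) z

/-! ### Cardinal representations -/

/-- `card^ℕ (f) = n`: the domain of `f` is finite with `n` elements. -/
def cardN (f : ℕ →. ℕ) (n : ℕ) : Prop := f.Dom.encard = n

/-- `card^ℤ (f, g) = z`: the domains of `f` and `g` are finite and `z` is the difference of their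
cardinals. -/
def cardZ (q : (ℕ →. ℕ) × (ℕ →. ℕ)) (z : ℤ) : Prop :=
  q.1.Dom.Finite ∧ q.2.Dom.Finite ∧ (q.1.Dom.ncard : ℤ) - (q.2.Dom.ncard : ℤ) = z

/-! ### Ordinal representation -/

/-- The field of the binary relation `domain f` on `ℕ`. -/
def RelField (f : ℕ × ℕ →. ℕ) : Type := {x : ℕ // ∃ y, (x, y) ∈ f.Dom ∨ (y, x) ∈ f.Dom}

/-- The preorder on its field generated by the relation `domain f`: its (reflexive and)
transitive closure. -/
instance RelField.preorder (f : ℕ × ℕ →. ℕ) : Preorder (RelField f) where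
  le x y := Relation.ReflTransGen (fun a b => (a, b) ∈ f.Dom) x.1 y.1
  le_refl _ := Relation.ReflTransGen.refl
  le_trans _ _ _ h k := Relation.ReflTransGen.trans h k

/-- `ord^ℕ (f) = n`: the quotient order associated to the transitive closure of `domain f` is a
finite total order, of order type `n`. -/
def ordN (f : ℕ × ℕ →. ℕ) (n : ℕ) : Prop :=
  Nonempty (Antisymmetrization (RelField f) (· ≤ ·) ≃o Fin n)

/-! ### The complexities, relative to the chosen languages -/

/-- Kolmogorov complexity `K`, and `K'` if `U` is a language with oracle `∅'`. -/
def Khalt (U : List Bool → Part ℕ) : ℕ → ℕ∞ := complexity haltOut U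

/-- The complexity `K^∞`, and `K'^∞` if `U` is a language with oracle `∅'`. -/
def Kinf (U : List Bool → ℕ → Bool) : ℕ → ℕ∞ := complexity unaryOut U

def KChurchN (U : List Bool → PR → PR) : ℕ → ℕ∞ := complexity churchN U

/-- The restriction to `ℕ` of the complexity of `Church^ℤ` on effective operations. -/
def KChurchZ (U : List Bool → PR → PR) : ℕ → ℕ∞ := fun n => complexity churchZ U (n : ℤ)

/-- The restriction to `ℕ` of the complexity of `Church^ℤ` on operations on Goedel numbers. -/
def KChurchZCode (U : List Bool → Code → PR) : ℕ → ℕ∞ :=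
  fun n => complexity churchZCode U (n : ℤ)

def KcardN (U : List Bool → ℕ →. ℕ) : ℕ → ℕ∞ := complexity cardN U

/-- The restriction to `ℕ` of the complexity of `card^ℤ`. -/
def KcardZ (U : List Bool → (ℕ →. ℕ) × (ℕ →. ℕ)) : ℕ → ℕ∞ :=
  fun n => complexity cardZ U (n : ℤ)

def Kord (U : List Bool → ℕ × ℕ →. ℕ) : ℕ → ℕ∞ := complexity ordN U

end KRep

end

open KRep

noncomputable section

namespace KRep

open Nat.Partrec (Code)
open Nat.Partrec.Code
open Encodable Filter

/-! ### Calculus of comparisons up to an additive constant -/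

/-! Each equality comes from two translations of languages that keep the number named and lengthen
programs by at most a constant (`Reduces`). The exponent of an iterator is read off by applying it
to the successor function at `0`, and conversely a computed `n` gives an iterator; this settles
Church's representations. Enumerating a domain without repetition is the same as printing in unary,
which settles `cardN`.

The oracle cases rest on the limit lemma (`exists_approximates_nat`, `recursiveIn_of_limit`): a
computation with oracle `∅'` is the limit of a computable sequence. Such a limit equals the total
increase minus the total decrease of the sequence, and these are the cardinals of two enumerable
sets; this gives `cardZ`. For `ordN`, the classes of an enumerable preorder are counted by their
least elements, which form a set decidable in `∅'`. Conversely a set decidable in `∅'` is first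
replaced by a co-enumerable set of the same cardinal, by attaching to each element the stage at
which its approximation settles (`encard_settles_true`). For co-enumerable `S`, making `x` and `x +
1` equivalent when `x ∉ S` is an enumerable process, and leaves `|S| + 1` classes (`ordN_of_dom`).

For strictness, the stronger class has a language in which every word `p` names a number that no
word of length at most `2 * |p|` names in the weaker language (`Optimal.exists_add_lt`). At two
levels this number is the cardinal of a disjoint union of sets with `v + 1` elements, one for each
output `v` of a short program; between `cardN` and `∅'` it is the least number that is not the
cardinal of a short program.

Strongly universal languages come from uniform enumerations. Only effective operations need an
argument: they are monotone and determined by finite functions (Rice-Shapiro, Myhill-Shepherdson),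
so they are exactly what consistent lists of finite instructions define (`exists_effOp_eq`). -/

theorem LeCt.trans {f g h : ℕ → ℕ∞} (hfg : LeCt f g) (hgh : LeCt g h) : LeCt f h := by
  obtain ⟨c, hc⟩ := hfg
  obtain ⟨d, hd⟩ := hgh
  refine ⟨d + c, fun n => (hc n).trans ?_⟩
  push_cast
  rw [← add_assoc]
  gcongr
  exact hd n

theorem EqCt.symm {f g : ℕ → ℕ∞} (h : EqCt f g) : EqCt g f := ⟨h.2, h.1⟩

theorem EqCt.trans {f g h : ℕ → ℕ∞} (hfg : EqCt f g) (hgh : EqCt g h) : EqCt f h :=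
  ⟨hfg.1.trans hgh.1, hgh.2.trans hfg.2⟩

theorem LtCt.of_leCt {f f' g g' : ℕ → ℕ∞} (h : LtCt f g) (hf : LeCt f' f) (hg : LeCt g g') :
    LtCt f' g' := by
  refine ⟨(hf.trans h.1).trans hg, fun c => ?_⟩
  obtain ⟨a, ha⟩ := hf
  obtain ⟨b, hb⟩ := hg
  obtain ⟨n, hn⟩ := h.2 (a + c + b)
  refine ⟨n, ?_⟩
  have h1 : f' n + c + b ≤ f n + (a + c + b : ℕ) := by
    push_cast
    rw [← add_assoc, ← add_assoc]
    gcongr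
    exact ha n
  exact lt_of_add_lt_add_right ((h1.trans_lt hn).trans_le (hb n))

/-! ### Complexities and reductions between classes of languages -/

theorem complexity_le {E α : Type} {ρ : E → α → Prop} {U : List Bool → E} {n : α} {p : List Bool}
    (h : ρ (U p) n) : complexity ρ U n ≤ p.length :=
  iInf₂_le p h

theorem le_complexity {E α : Type} {ρ : E → α → Prop} {U : List Bool → E} {n : α} {m : ℕ∞}
    (h : ∀ p, ρ (U p) n → m ≤ p.length) : m ≤ complexity ρ U n :=
  le_iInf₂ h

theorem LeCt.of_exists {E E' : Type} {ρ : E → ℕ → Prop} {ρ' : E' → ℕ → Prop}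
    {U : List Bool → E} {V : List Bool → E'} (c : ℕ)
    (h : ∀ p n, ρ' (V p) n → ∃ q, ρ (U q) n ∧ q.length ≤ p.length + c) :
    LeCt (complexity ρ U) (complexity ρ' V) := by
  refine ⟨c, fun n => ?_⟩
  rw [complexity, complexity, ENat.iInf_add]
  refine le_iInf fun p => ?_
  rcases em (ρ' (V p) n) with hp | hp
  · obtain ⟨q, hq, hl⟩ := h p n hp
    simp only [hp, iInf_pos]
    exact (complexity_le hq).trans (mod_cast hl)
  · simp [hp]

theorem LeCt.of_forall {E E' : Type} {ρ : E → ℕ → Prop} {ρ' : E' → ℕ → Prop}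
    {U : List Bool → E} {V : List Bool → E'} (h : ∀ p n, ρ' (V p) n → ρ (U p) n) :
    LeCt (complexity ρ U) (complexity ρ' V) :=
  .of_exists 0 fun p n hp => ⟨p, h p n hp, le_rfl⟩

theorem StronglyUniversal.optimal {E : Type} {C : (List Bool → E) → Prop} {U : List Bool → E}
    (h : StronglyUniversal C U) (ρ : E → ℕ → Prop) : Optimal C ρ U := by
  obtain ⟨hU, comp, -, hr, hl⟩ := h
  refine ⟨hU, fun V hV => ?_⟩
  obtain ⟨e, rfl⟩ : V ∈ Set.range fun (e p : List Bool) => U (comp e p) := hr ▸ hV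
  obtain ⟨c, hc⟩ := hl e
  exact .of_exists c fun p n hp => ⟨comp e p, hp, hc p⟩

/-- Every language of the class `C` can be replaced, up to an additive constant, by a language of
the class `C'`. -/
def Reduces {E E' : Type} (C : (List Bool → E) → Prop) (ρ : E → ℕ → Prop)
    (C' : (List Bool → E') → Prop) (ρ' : E' → ℕ → Prop) : Prop :=
  ∀ V, C V → ∃ W, C' W ∧ LeCt (complexity ρ' W) (complexity ρ V)

section

variable {E E' : Type} {C : (List Bool → E) → Prop} {ρ : E → ℕ → Prop}
  {C' : (List Bool → E') → Prop} {ρ' : E' → ℕ → Prop}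

theorem Reduces.leCt {V : List Bool → E} {U' : List Bool → E'} (h : Reduces C ρ C' ρ')
    (hV : C V) (hU' : Optimal C' ρ' U') : LeCt (complexity ρ' U') (complexity ρ V) :=
  let ⟨W, hW, hVW⟩ := h V hV
  (hU'.2 W hW).trans hVW

theorem Reduces.eqCt {U : List Bool → E} {U' : List Bool → E'} (h : Reduces C ρ C' ρ')
    (h' : Reduces C' ρ' C ρ) (hU : Optimal C ρ U) (hU' : Optimal C' ρ' U') :
    EqCt (complexity ρ U) (complexity ρ' U') :=
  ⟨h'.leCt hU'.1 hU, h.leCt hU.1 hU'⟩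

/-- Through this transfer, optimal languages with oracle `∅'` come from the oracle-free universal
languages, and no universal oracle machine is needed. -/
theorem Reduces.exists_optimal {U : List Bool → E} (h : Reduces C ρ C' ρ')
    (h' : Reduces C' ρ' C ρ) (hU : Optimal C ρ U) : ∃ U', Optimal C' ρ' U' :=
  let ⟨W, hW, hWU⟩ := h U hU.1
  ⟨W, hW, fun _ hV => hWU.trans (h'.leCt hV hU)⟩

/-- If the words of length `j` in a language of the class `C` name numbers whose complexity in
the language `V` exceeds `2 * j`, then the complexity in `V` exceeds the one in an optimal language
of the class `C` by an unbounded amount. -/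
theorem Optimal.exists_add_lt {U W : List Bool → E} {V : List Bool → E'}
    (hU : Optimal C ρ U) (hW : C W)
    (h : ∀ p, ∃ n, ρ (W p) n ∧ ∀ q, ρ' (V q) n → 2 * p.length < q.length) (c : ℕ) :
    ∃ n, complexity ρ U n + c < complexity ρ' V n := by
  obtain ⟨d, hd⟩ := hU.2 W hW
  -- The length `d + c` makes the upper bound `(d + c) + d`, increased by `c`, fall just below the
  -- lower bound `2 * (d + c) + 1`.
  obtain ⟨n, hn, hV⟩ := h (List.replicate (d + c) true)
  refine ⟨n, ?_⟩
  have h1 : complexity ρ U n ≤ (d + c + d : ℕ) := by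
    refine (hd n).trans ?_
    push_cast
    gcongr
    simpa using complexity_le hn
  have h2 : (2 * (d + c) + 1 : ℕ) ≤ complexity ρ' V n :=
    le_complexity fun q hq => by
      have := hV q hq
      rw [List.length_replicate] at this
      exact mod_cast this
  refine lt_of_lt_of_le ?_ h2
  calc complexity ρ U n + c ≤ (d + c + d : ℕ) + c := by gcongr
    _ = ((d + c + d + c : ℕ) : ℕ∞) := by push_cast; rfl
    _ < (2 * (d + c) + 1 : ℕ) := by rw [Nat.cast_lt]; omega

end

/-! ### Words that start with the unary representation of an index -/

/-- The decomposition of the word `1ᵏ0q` into `k` and `q`. -/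
def splitWord (w : List Bool) : ℕ × List Bool :=
  ((w.takeWhile id).length, (w.dropWhile id).tail)

/-- The word `1ᵏ0q`, where `k` is the length of `e`. -/
def prefixWord (e q : List Bool) : List Bool := e.map (fun _ => true) ++ false :: q

theorem splitWord_prefixWord (e q : List Bool) :
    splitWord (prefixWord e q) = (e.length, q) := by
  induction e with
  | nil => simp [splitWord, prefixWord]
  | cons b e ih => simp [splitWord, prefixWord]

theorem primrec_splitWord : Primrec splitWord :=
  Primrec.pair (Primrec.list_length.comp (Primrec.list_takeWhile Primrec.id))
    (Primrec.list_tail.comp (Primrec.list_dropWhile Primrec.id))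

theorem primrec_prefixWord : Primrec₂ prefixWord :=
  Primrec.list_append.comp
    (Primrec.list_map Primrec.fst (Primrec.const true).to₂)
    (Primrec.list_cons.comp (Primrec.const false) Primrec.snd)

/-- A uniform enumeration of a class yields a strongly universal language. -/
theorem exists_stronglyUniversal {E : Type} {C : (List Bool → E) → Prop}
    (F : ℕ → List Bool → E) (hF : C fun w => F (splitWord w).1 (splitWord w).2)
    (hC : ∀ V, C V ↔ ∃ k, F k = V) : ∃ U, StronglyUniversal C U := by
  -- Only the length of `e` serves as an index, so every index `k` is reached by a word, at the cost
  -- of `k + 1` extra symbols.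
  refine ⟨_, hF, prefixWord, primrec_prefixWord.to_comp, ?_, fun e => ⟨e.length + 1, fun p => ?_⟩⟩
  · ext V
    simp only [splitWord_prefixWord, Set.mem_range, Set.mem_ofPred_eq, hC]
    exact ⟨fun ⟨e, he⟩ => ⟨e.length, he⟩,
      fun ⟨k, hk⟩ => ⟨List.replicate k true, by simpa using hk⟩⟩
  · simp only [prefixWord, List.length_append, List.length_map, List.length_cons]
    omega

/-! ### Bounded quantifiers -/

theorem primrecPred_forall_lt {α : Type} [Primcodable α] {R : ℕ → α → Prop} (h : PrimrecRel R)
    {n : α → ℕ} (hn : Primrec n) : PrimrecPred fun a => ∀ x < n a, R x a :=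
  (h.forall_mem_list.comp (Primrec.list_range.comp hn) Primrec.id).of_eq fun a => by simp

theorem primrecPred_exists_lt {α : Type} [Primcodable α] {R : ℕ → α → Prop} (h : PrimrecRel R)
    {n : α → ℕ} (hn : Primrec n) : PrimrecPred fun a => ∃ x < n a, R x a :=
  (h.exists_mem_list.comp (Primrec.list_range.comp hn) Primrec.id).of_eq fun a => by simp

/-! ### Goedel numbers and universal functions -/

section

variable {α σ : Type} [Primcodable α] [Primcodable σ]

theorem exists_eval_eq {f : α →. σ} (hf : Partrec f) :
    ∃ c : Code, ∀ a, c.eval (encode a) = (f a).map encode := by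
  obtain ⟨c, hc⟩ := exists_code.1 hf
  exact ⟨c, fun a => by simp [hc]⟩

/-- The s-m-n theorem. -/
theorem exists_primrec_code {g : α → ℕ →. ℕ} (hg : Partrec₂ g) :
    ∃ h : α → Code, Primrec h ∧ ∀ a, (h a).eval = g a := by
  obtain ⟨c, hc⟩ := exists_eval_eq hg
  refine ⟨fun a => curry c (encode a),
    primrec₂_curry.comp (Primrec.const c) Primrec.encode, fun a => funext fun x => ?_⟩
  have := hc (a, x)
  rw [eval_curry, ← encode_nat x, ← encode_prod_val, this]
  simp [Part.map_id']

/-- The partial recursive function from `α` with Goedel number `k`. -/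
def univ (α : Type) [Primcodable α] (k : ℕ) : α →. ℕ :=
  fun a => (Denumerable.ofNat Code k).eval (encode a)

theorem partrec₂_univ : Partrec₂ (univ α) :=
  eval_part.comp ((Computable.ofNat Code).comp Computable.fst)
    (Computable.encode.comp Computable.snd)

theorem partrec_univ (k : ℕ) : Partrec (univ α k) :=
  partrec₂_univ.comp (Computable.const k) Computable.id

theorem exists_univ_eq {f : α →. ℕ} (hf : Partrec f) : ∃ k, univ α k = f := by
  obtain ⟨c, hc⟩ := exists_eval_eq hf
  exact ⟨encode c, funext fun a => by simp [univ, hc, Part.map_id']⟩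

end

/-! ### Strongly universal languages -/

theorem exists_stronglyUniversal_funLang (X : Type) [Primcodable X] :
    ∃ U, StronglyUniversal (FunLang (X := X)) U := by
  refine exists_stronglyUniversal (fun k q x => univ (List Bool × X) k (q, x)) ?_ fun V => ?_
  · have h := primrec_splitWord.to_comp.comp (Computable.fst (α := List Bool) (β := X))
    exact partrec₂_univ.comp (Computable.fst.comp h)
      ((Computable.snd.comp h).pair Computable.snd)
  · constructor
    · intro hV
      obtain ⟨k, hk⟩ := exists_univ_eq hV
      exact ⟨k, by simp only [hk]; rfl⟩
    · rintro ⟨k, rfl⟩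
      exact partrec_univ k

theorem exists_stronglyUniversal_pairLang : ∃ U, StronglyUniversal PairLang U := by
  refine exists_stronglyUniversal
    (fun k q => (fun x => univ (List Bool × ℕ) k.unpair.1 (q, x),
      fun x => univ (List Bool × ℕ) k.unpair.2 (q, x))) ?_ fun V => ?_
  · have h := primrec_splitWord.to_comp.comp (Computable.fst (α := List Bool) (β := ℕ))
    have hk := Computable.unpair.comp (Computable.fst.comp h)
    have hq := (Computable.snd.comp h).pair (Computable.snd (α := List Bool) (β := ℕ))
    exact ⟨partrec₂_univ.comp (Computable.fst.comp hk) hq,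
      partrec₂_univ.comp (Computable.snd.comp hk) hq⟩
  · constructor
    · rintro ⟨h₁, h₂⟩
      obtain ⟨k, hk⟩ := exists_univ_eq h₁
      obtain ⟨l, hl⟩ := exists_univ_eq h₂
      exact ⟨Nat.pair k l, by simp [hk, hl]⟩
    · rintro ⟨k, rfl⟩
      exact ⟨partrec_univ _, partrec_univ _⟩

/-- Total recursive `f` cannot be enumerated effectively, but here partiality is harmless: `h (k, q,
c)` is always a Goedel number, of the function that first computes the `k`-th partial function at
`(q, c)` and then runs the resulting code. -/
theorem exists_stronglyUniversal_codeLang : ∃ U, StronglyUniversal CodeLang U := by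
  obtain ⟨h, hh, hhe⟩ := exists_primrec_code
    (g := fun (a : ℕ × List Bool × Code) (x : ℕ) =>
      (univ (List Bool × Code) a.1 a.2).bind fun m => (Denumerable.ofNat Code m).eval x) <| by
    refine Partrec.bind (partrec₂_univ.comp (Computable.fst.comp Computable.fst)
      (Computable.snd.comp Computable.fst)) ?_
    exact eval_part.comp ((Computable.ofNat Code).comp Computable.snd)
      (Computable.snd.comp Computable.fst)
  refine exists_stronglyUniversal (fun k q c => PR.ofCode (h (k, q, c))) ?_ fun V => ?_
  · refine ⟨fun w c => h ((splitWord w).1, (splitWord w).2, c), ?_, fun _ _ => rfl⟩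
    have := primrec_splitWord.comp (Primrec.fst (α := List Bool) (β := Code))
    exact (hh.comp ((Primrec.fst.comp this).pair
      ((Primrec.snd.comp this).pair Primrec.snd))).to_comp
  · constructor
    · rintro ⟨f, hf, hV⟩
      obtain ⟨k, hk⟩ := exists_univ_eq (Computable.encode.comp hf).partrec
      refine ⟨k, funext fun q => funext fun c => ?_⟩
      rw [hV]
      refine Subtype.ext ?_
      simp only [PR.ofCode, hhe, hk]
      funext x
      simp
    · rintro ⟨k, rfl⟩
      exact ⟨fun q c => h (k, q, c), (hh.comp ((Primrec.const k).pair Primrec.id)).to_comp,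
        fun _ _ => rfl⟩

/-! ### Effective operations are continuous -/

/-- The partial function with Goedel number `c` extends the one with Goedel number `d`. -/
def CodeLe (d c : Code) : Prop := ∀ a, ∀ b ∈ d.eval a, b ∈ c.eval a

/-- The partial function given by `evaln n c`, which has a finite domain. -/
def truncate (c : Code) (n : ℕ) : ℕ →. ℕ := fun a => (evaln n c a : Part ℕ)

theorem partrec₂_truncate : Partrec₂ fun (q : Code × ℕ) => truncate q.1 q.2 := by
  refine Computable.ofOption (Primrec.to_comp ?_)
  exact primrec_evaln.comp (((Primrec.snd.comp Primrec.fst).pair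
    (Primrec.fst.comp Primrec.fst)).pair Primrec.snd)

/-- A Goedel number of `truncate c n`. -/
def truncateCode : Code × ℕ → Code := (exists_primrec_code partrec₂_truncate).choose

theorem primrec_truncateCode : Primrec truncateCode :=
  (exists_primrec_code partrec₂_truncate).choose_spec.1

theorem eval_truncateCode (q : Code × ℕ) : (truncateCode q).eval = truncate q.1 q.2 :=
  (exists_primrec_code partrec₂_truncate).choose_spec.2 q

theorem mem_truncate {c : Code} {n a b : ℕ} : b ∈ truncate c n a ↔ b ∈ evaln n c a :=
  Part.mem_ofOption

theorem codeLe_iff_of_truncate {d c : Code} {n : ℕ} :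
    CodeLe (truncateCode (d, n)) c ↔ ∀ a b, b ∈ evaln n d a → b ∈ c.eval a := by
  simp [CodeLe, eval_truncateCode, mem_truncate]

theorem exists_mem_evaln_iff {c : Code} {a b : ℕ} : (∃ s, b ∈ evaln s c a) ↔ b ∈ c.eval a :=
  evaln_complete.symm

theorem isSome_evaln_iff {c : Code} {a : ℕ} : (∃ s, (evaln s c a).isSome) ↔ (c.eval a).Dom := by
  simp only [Part.dom_iff_mem, ← exists_mem_evaln_iff, Option.isSome_iff_exists, Option.mem_def]
  exact exists_comm

theorem isSome_evaln_mono {c : Code} {a s t : ℕ} (hst : s ≤ t) (h : (evaln s c a).isSome) :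
    (evaln t c a).isSome := by
  obtain ⟨b, hb⟩ := Option.isSome_iff_exists.1 h
  exact Option.isSome_iff_exists.2 ⟨b, evaln_mono hst hb⟩

theorem mem_rfindOpt_iff {α : Type} {g : ℕ → Option α} {b : α}
    (hg : ∀ s t a a', a ∈ g s → a' ∈ g t → a = a') : b ∈ Nat.rfindOpt g ↔ ∃ s, b ∈ g s := by
  refine ⟨Nat.rfindOpt_spec, fun ⟨s, hs⟩ => ?_⟩
  have hd : (Nat.rfindOpt g).Dom := Nat.rfindOpt_dom.2 ⟨s, b, hs⟩
  obtain ⟨t, ht⟩ := Nat.rfindOpt_spec (Part.get_mem hd)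
  exact hg t s _ _ ht hs ▸ Part.get_mem hd

/-- The left side is enumerable in `k`, non-halting is not. Both halves of the Rice-Shapiro theorem
below end in this contradiction. -/
theorem not_forall_mem_eval_iff_not_halting {f : Code → Code} (hf : Computable f) (x y : ℕ) :
    ¬∀ k : Code, y ∈ (f k).eval x ↔ ¬(k.eval 0).Dom := by
  intro H
  refine ComputablePred.halting_problem_not_re 0 ?_
  have hp : Partrec fun k : Code => ((f k).eval x).bind fun v =>
      ((if v = y then some () else none : Option Unit) : Part Unit) := by
    refine Partrec.bind (eval_part.comp hf (Computable.const x)) ?_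
    refine Computable.ofOption (Primrec.to_comp ?_)
    exact Primrec.ite (Primrec.eq.comp Primrec.snd (Primrec.const y)) (Primrec.const _)
      (Primrec.const _)
  refine hp.dom_re.of_eq fun k => ?_
  rw [← H k]
  simp only [Part.dom_iff_mem, Part.mem_bind_iff, Part.mem_ofOption]
  constructor
  · rintro ⟨_, v, hv, h⟩
    split_ifs at h with hvy
    · exact hvy ▸ hv
    · simp at h
  · exact fun h => ⟨(), y, h, by simp⟩

section

variable {f : Code → Code} (hf : Computable f)
  (hext : ∀ c d : Code, c.eval = d.eval → (f c).eval = (f d).eval)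
include hf hext

/-- Let `h k` imitate `c` only as long as `k` has not halted. It computes `c` if `k` never halts,
and otherwise a truncation of `c`; if no truncation sufficed for `y`, non-halting would be
enumerable. -/
theorem exists_mem_eval_truncateCode {c : Code} {x y : ℕ} (hy : y ∈ (f c).eval x) :
    ∃ n, y ∈ (f (truncateCode (c, n))).eval x := by
  by_contra! hn
  have hpart : Partrec₂ fun (k : Code) (a : ℕ) => Nat.rfindOpt fun s =>
      bif (evaln s k 0).isSome then none else evaln s c a := by
    refine Partrec.rfindOpt (Primrec.to_comp ?_)
    refine Primrec.cond (Primrec.option_isSome.comp (primrec_evaln.comp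
      ((Primrec.snd.pair (Primrec.fst.comp Primrec.fst)).pair (Primrec.const 0))))
      (Primrec.const none) (primrec_evaln.comp
      ((Primrec.snd.pair (Primrec.const c)).pair (Primrec.snd.comp Primrec.fst)))
  obtain ⟨h, hh, he⟩ := exists_primrec_code hpart
  refine not_forall_mem_eval_iff_not_halting (hf.comp hh.to_comp) x y fun k => ?_
  have hmem : ∀ a b, b ∈ (h k).eval a ↔ ∃ s, ¬(evaln s k 0).isSome ∧ b ∈ evaln s c a := by
    intro a b
    rw [he, mem_rfindOpt_iff]
    · refine exists_congr fun s => ?_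
      cases (evaln s k 0).isSome <;> simp
    · intro s t u v hu hv
      have key : ∀ {s u}, u ∈ (bif (evaln s k 0).isSome then none else evaln s c a) →
          u ∈ c.eval a := fun {s u} hu => by
        cases hs : (evaln s k 0).isSome <;> simp only [hs, cond_true, cond_false] at hu
        · exact evaln_sound hu
        · simp at hu
      exact Part.mem_unique (key hu) (key hv)
  by_cases hk : (k.eval 0).Dom
  · simp only [hk, not_true_eq_false, iff_false]
    have hs := isSome_evaln_iff.2 hk
    classical
    -- The stages before the halting of `k` are those up to `N`; stage `0` is never the halting
    -- stage because `evaln 0` is undefined everywhere.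
    obtain ⟨N, hN⟩ : ∃ N, Nat.find hs = N + 1 :=
      Nat.exists_eq_succ_of_ne_zero fun h0 => by
        have := Nat.find_spec hs
        simp [h0, evaln] at this
    have : (h k).eval = (truncateCode (c, N)).eval := by
      funext a
      ext b
      rw [hmem, eval_truncateCode, mem_truncate]
      constructor
      · rintro ⟨s, hsk, hb⟩
        refine evaln_mono ?_ hb
        by_contra! hlt
        exact hsk (isSome_evaln_mono (by omega) (Nat.find_spec hs))
      · exact fun hb => ⟨N, Nat.find_min hs (by omega), hb⟩
    rw [hext _ _ this]
    exact hn N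
  · simp only [hk, not_false_eq_true, iff_true]
    have : (h k).eval = c.eval := by
      funext a
      ext b
      rw [hmem, ← exists_mem_evaln_iff]
      exact exists_congr fun s => and_iff_right fun hs => hk (isSome_evaln_iff.1 ⟨s, hs⟩)
    rw [hext _ _ this]
    exact hy

/-- Here `h k` imitates `c` and switches to its extension `d` when `k` halts. A value `y` obtained
from `c` and lost on `d` would make non-halting enumerable. -/
theorem mem_eval_of_codeLe {c d : Code} (hcd : CodeLe c d) {x y : ℕ} (hy : y ∈ (f c).eval x) :
    y ∈ (f d).eval x := by
  by_contra hn
  have hpart : Partrec₂ fun (k : Code) (a : ℕ) => Nat.rfindOpt fun s =>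
      bif (evaln s k 0).isSome then evaln s d a else evaln s c a := by
    refine Partrec.rfindOpt (Primrec.to_comp ?_)
    refine Primrec.cond (Primrec.option_isSome.comp (primrec_evaln.comp
      ((Primrec.snd.pair (Primrec.fst.comp Primrec.fst)).pair (Primrec.const 0))))
      (primrec_evaln.comp
      ((Primrec.snd.pair (Primrec.const d)).pair (Primrec.snd.comp Primrec.fst)))
      (primrec_evaln.comp
      ((Primrec.snd.pair (Primrec.const c)).pair (Primrec.snd.comp Primrec.fst)))
  obtain ⟨h, hh, he⟩ := exists_primrec_code hpart
  refine not_forall_mem_eval_iff_not_halting (hf.comp hh.to_comp) x y fun k => ?_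
  have hmem : ∀ a b, b ∈ (h k).eval a ↔
      ∃ s, b ∈ bif (evaln s k 0).isSome then evaln s d a else evaln s c a := by
    intro a b
    rw [he, mem_rfindOpt_iff]
    intro s t u v hu hv
    have key : ∀ {s u}, u ∈ (bif (evaln s k 0).isSome then evaln s d a else evaln s c a) →
        u ∈ d.eval a := fun {s u} hu => by
      cases hs : (evaln s k 0).isSome <;> simp only [hs, cond_true, cond_false] at hu
      · exact hcd _ _ (evaln_sound hu)
      · exact evaln_sound hu
    exact Part.mem_unique (key hu) (key hv)
  by_cases hk : (k.eval 0).Dom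
  · simp only [hk, not_true_eq_false, iff_false]
    obtain ⟨N, hN⟩ := isSome_evaln_iff.2 hk
    have : (h k).eval = d.eval := by
      funext a
      ext b
      rw [hmem]
      constructor
      · rintro ⟨s, hs⟩
        cases hsk : (evaln s k 0).isSome <;> simp only [hsk, cond_true, cond_false] at hs
        · exact hcd _ _ (evaln_sound hs)
        · exact evaln_sound hs
      · intro hb
        obtain ⟨s, hs⟩ := exists_mem_evaln_iff.2 hb
        refine ⟨max s N, ?_⟩
        rw [isSome_evaln_mono (le_max_right s N) hN, cond_true]
        exact evaln_mono (le_max_left s N) hs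
    rw [hext _ _ this]
    exact hn
  · simp only [hk, not_false_eq_true, iff_true]
    have : (h k).eval = c.eval := by
      funext a
      ext b
      rw [hmem, ← exists_mem_evaln_iff]
      refine exists_congr fun s => ?_
      cases hs : (evaln s k 0).isSome
      · rfl
      · exact absurd (isSome_evaln_iff.1 ⟨s, hs⟩) hk
    rw [hext _ _ this]
    exact hy

end

/-! ### A universal effective operation -/

/-- The finite functions `truncate q.1 q.2` and `truncate r.1 r.2` agree on their common domain. -/
def Compat (q r : Code × ℕ) : Prop :=
  ∀ a < q.2, evaln q.2 q.1 a = none ∨ evaln r.2 r.1 a = none ∨ evaln q.2 q.1 a = evaln r.2 r.1 a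

/-- At stage `t`, the function with Goedel number `c` is seen to extend `truncate q.1 q.2`. -/
def SubAt (q : Code × ℕ) (c : Code × ℕ) : Prop :=
  ∀ a < q.2, evaln q.2 q.1 a = none ∨ evaln q.2 q.1 a = evaln c.2 c.1 a

theorem primrec_evaln_pair {α : Type} [Primcodable α] {q : α → Code × ℕ} {a : α → ℕ}
    (hq : Primrec q) (ha : Primrec a) : Primrec fun x => evaln (q x).2 (q x).1 (a x) :=
  primrec_evaln.comp (((Primrec.snd.comp hq).pair (Primrec.fst.comp hq)).pair ha)

theorem primrecRel_compat : PrimrecRel Compat := by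
  have h : PrimrecRel fun (a : ℕ) (p : (Code × ℕ) × (Code × ℕ)) =>
      evaln p.1.2 p.1.1 a = none ∨ evaln p.2.2 p.2.1 a = none ∨
        evaln p.1.2 p.1.1 a = evaln p.2.2 p.2.1 a := by
    have h1 := primrec_evaln_pair
      (Primrec.fst.comp (Primrec.snd (α := ℕ) (β := (Code × ℕ) × (Code × ℕ)))) Primrec.fst
    have h2 := primrec_evaln_pair
      (Primrec.snd.comp (Primrec.snd (α := ℕ) (β := (Code × ℕ) × (Code × ℕ)))) Primrec.fst
    exact (Primrec.eq.comp h1 (Primrec.const none)).or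
      ((Primrec.eq.comp h2 (Primrec.const none)).or (Primrec.eq.comp h1 h2))
  exact primrecPred_forall_lt h (Primrec.snd.comp Primrec.fst)

theorem primrecRel_subAt : PrimrecRel SubAt := by
  have h : PrimrecRel fun (a : ℕ) (p : (Code × ℕ) × (Code × ℕ)) =>
      evaln p.1.2 p.1.1 a = none ∨ evaln p.1.2 p.1.1 a = evaln p.2.2 p.2.1 a := by
    have h1 := primrec_evaln_pair
      (Primrec.fst.comp (Primrec.snd (α := ℕ) (β := (Code × ℕ) × (Code × ℕ)))) Primrec.fst
    have h2 := primrec_evaln_pair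
      (Primrec.snd.comp (Primrec.snd (α := ℕ) (β := (Code × ℕ) × (Code × ℕ)))) Primrec.fst
    exact (Primrec.eq.comp h1 (Primrec.const none)).or (Primrec.eq.comp h1 h2)
  exact primrecPred_forall_lt h (Primrec.snd.comp Primrec.fst)

/-- A finite function has finitely many values, so a single stage confirms them all. -/
theorem exists_subAt_iff {q : Code × ℕ} {c : Code} :
    (∃ t, SubAt q (c, t)) ↔ CodeLe (truncateCode q) c := by
  rw [codeLe_iff_of_truncate]
  constructor
  · rintro ⟨t, ht⟩ a b hb
    rcases ht a (evaln_bound hb) with h | h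
    · simp [h] at hb
    · exact evaln_sound (h ▸ hb : b ∈ evaln t c a)
  · intro h
    suffices ∀ᶠ t in Filter.atTop, ∀ a ∈ Set.Iio q.2,
        evaln q.2 q.1 a = none ∨ evaln q.2 q.1 a = evaln t c a from this.exists
    rw [Filter.eventually_all_finite (Set.finite_Iio _)]
    intro a _
    cases hb : evaln q.2 q.1 a with
    | none => simp
    | some b =>
      obtain ⟨t, ht⟩ := exists_mem_evaln_iff.2 (h a b hb)
      filter_upwards [Filter.eventually_ge_atTop t] with u hu
      exact Or.inr (evaln_mono hu ht).symm

theorem compat_of_codeLe {q r : Code × ℕ} {c : Code} (hq : CodeLe (truncateCode q) c)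
    (hr : CodeLe (truncateCode r) c) : Compat q r := by
  rw [codeLe_iff_of_truncate] at hq hr
  intro a _
  cases hb : evaln q.2 q.1 a with
  | none => simp
  | some b =>
    cases hb' : evaln r.2 r.1 a with
    | none => simp
    | some b' => rw [Part.mem_unique (hq a b hb) (hr a b' hb')]; simp

/-- The union of the two finite functions is a common extension. -/
theorem exists_codeLe_of_compat {q r : Code × ℕ} (h : Compat q r) :
    ∃ c, CodeLe (truncateCode q) c ∧ CodeLe (truncateCode r) c := by
  have hp : Nat.Partrec fun a => ((evaln q.2 q.1 a <|> evaln r.2 r.1 a : Option ℕ) : Part ℕ) := by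
    refine Partrec.nat_iff.1 (Computable.ofOption (Primrec.to_comp ?_))
    exact Primrec.option_orElse.comp (primrec_evaln_pair (Primrec.const q) Primrec.id)
      (primrec_evaln_pair (Primrec.const r) Primrec.id)
  obtain ⟨c, hc⟩ := exists_code.1 hp
  refine ⟨c, codeLe_iff_of_truncate.2 fun a b hb => ?_, codeLe_iff_of_truncate.2 fun a b hb => ?_⟩
  · rw [Option.mem_def] at hb
    simp [hc, hb]
  · rw [Option.mem_def] at hb
    by_cases ha : a < q.2
    · rcases h a ha with h | h | h
      · simp [hc, hb, h]
      · simp [hb] at h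
      · simp [hc, hb, h]
    -- `Compat` says nothing about arguments from `q.2` on, but `evaln q.2` is undefined there.
    · have : evaln q.2 q.1 a = none := by
        by_contra hne
        obtain ⟨b, hb⟩ := Option.ne_none_iff_exists'.1 hne
        exact ha (evaln_bound hb)
      simp [hc, hb, this]

/-- The finite function named by the index `i` of an instruction. -/
def instrArg (i : ℕ) : Code × ℕ := Denumerable.ofNat (Code × ℕ) i.unpair.2

theorem instrArg_pair (s : ℕ) (q : Code × ℕ) : instrArg (Nat.pair s (encode q)) = q := by
  rw [instrArg, Nat.unpair_pair, Denumerable.ofNat_encode]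

/-- The value prescribed at `b.2.2`, for the program `b.2.1`, by the `i`-th instruction of the
operation with index `b.1`, to all functions that extend `instrArg i`. -/
def instrVal (b : ℕ × List Bool × ℕ) (i : ℕ) : Option ℕ :=
  evaln i.unpair.1 (Denumerable.ofNat Code b.1) (encode (b.2.1, b.2.2, instrArg i))

/-- The `i`-th instruction does not contradict an earlier one. -/
def Accepted (b : ℕ × List Bool × ℕ) (i : ℕ) : Prop :=
  ∀ j < i, instrVal b j = none ∨ instrVal b j = instrVal b i ∨ ¬Compat (instrArg i) (instrArg j)

open Classical in
/-- The effective operations given by enumerations of instructions. -/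
def effOp (b : ℕ × List Bool × ℕ) (c : Code) : Part ℕ :=
  Nat.rfindOpt fun n => if Accepted b n.unpair.1 ∧ SubAt (instrArg n.unpair.1) (c, n.unpair.2)
    then instrVal b n.unpair.1 else none

theorem primrec_instrArg : Primrec instrArg :=
  (Primrec.ofNat _).comp (Primrec.snd.comp Primrec.unpair)

theorem primrec₂_instrVal : Primrec₂ instrVal := by
  have hb := Primrec.fst (α := ℕ × List Bool × ℕ) (β := ℕ)
  refine primrec_evaln.comp (Primrec.pair (Primrec.pair
    (Primrec.fst.comp (Primrec.unpair.comp Primrec.snd))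
    ((Primrec.ofNat Code).comp (Primrec.fst.comp hb))) (Primrec.encode.comp ?_))
  exact (Primrec.fst.comp (Primrec.snd.comp hb)).pair
    ((Primrec.snd.comp (Primrec.snd.comp hb)).pair (primrec_instrArg.comp Primrec.snd))

theorem primrecRel_accepted : PrimrecRel Accepted := by
  have h : PrimrecRel fun (j : ℕ) (p : (ℕ × List Bool × ℕ) × ℕ) =>
      instrVal p.1 j = none ∨ instrVal p.1 j = instrVal p.1 p.2 ∨
        ¬Compat (instrArg p.2) (instrArg j) := by
    have hb := Primrec.fst.comp (Primrec.snd (α := ℕ) (β := (ℕ × List Bool × ℕ) × ℕ))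
    have hi := Primrec.snd.comp (Primrec.snd (α := ℕ) (β := (ℕ × List Bool × ℕ) × ℕ))
    have hj := primrec₂_instrVal.comp hb Primrec.fst
    exact (Primrec.eq.comp hj (Primrec.const none)).or
      ((Primrec.eq.comp hj (primrec₂_instrVal.comp hb hi)).or
        (primrecRel_compat.comp (primrec_instrArg.comp hi)
          (primrec_instrArg.comp Primrec.fst)).not)
  exact primrecPred_forall_lt h Primrec.snd

theorem partrec₂_effOp : Partrec₂ effOp := by
  classical
  refine Partrec.rfindOpt (Primrec.to_comp ?_)
  have hb := Primrec.fst.comp (Primrec.fst (α := (ℕ × List Bool × ℕ) × Code) (β := ℕ))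
  have hc := Primrec.snd.comp (Primrec.fst (α := (ℕ × List Bool × ℕ) × Code) (β := ℕ))
  have hn := Primrec.unpair.comp (Primrec.snd (α := (ℕ × List Bool × ℕ) × Code) (β := ℕ))
  have hi := Primrec.fst.comp hn
  exact Primrec.ite ((primrecRel_accepted.comp hb hi).and
    (primrecRel_subAt.comp (primrec_instrArg.comp hi) (hc.pair (Primrec.snd.comp hn))))
    (primrec₂_instrVal.comp hb hi) (Primrec.const none)

/-- Of two contradictory instructions with compatible arguments, the later one is rejected because
of the earlier one. -/
theorem Accepted.eq {b : ℕ × List Bool × ℕ} {i j : ℕ} {y z : ℕ} (hi : Accepted b i)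
    (hj : Accepted b j) (hy : y ∈ instrVal b i) (hz : z ∈ instrVal b j)
    (hij : Compat (instrArg i) (instrArg j)) (hji : Compat (instrArg j) (instrArg i)) :
    y = z := by
  rw [Option.mem_def] at hy hz
  rcases lt_trichotomy i j with h | rfl | h
  · simpa [hy, hz, hji] using hj i h
  · simpa [hy] using hz
  · simpa [hy, hz, hij, eq_comm] using hi j h

theorem mem_effOp {b : ℕ × List Bool × ℕ} {c : Code} {y : ℕ} :
    y ∈ effOp b c ↔
      ∃ i, y ∈ instrVal b i ∧ Accepted b i ∧ CodeLe (truncateCode (instrArg i)) c := by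
  classical
  rw [effOp, mem_rfindOpt_iff]
  · simp only [← exists_subAt_iff, Option.mem_def, Option.ite_none_right_eq_some]
    constructor
    · rintro ⟨n, ⟨h1, h2⟩, h3⟩
      exact ⟨_, h3, h1, _, h2⟩
    · rintro ⟨i, h3, h1, t, h2⟩
      exact ⟨Nat.pair i t, by simpa using ⟨⟨h1, h2⟩, h3⟩⟩
  · intro s t y z hy hz
    simp only [Option.mem_def, Option.ite_none_right_eq_some] at hy hz
    have h1 := exists_subAt_iff.1 ⟨_, hy.1.2⟩
    have h2 := exists_subAt_iff.1 ⟨_, hz.1.2⟩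
    exact hy.1.1.eq hz.1.1 hy.2 hz.2 (compat_of_codeLe h1 h2) (compat_of_codeLe h2 h1)

theorem effOp_congr {b : ℕ × List Bool × ℕ} {c d : Code} (h : c.eval = d.eval) :
    effOp b c = effOp b d := by
  ext y
  simp only [mem_effOp, CodeLe, h]

/-- The instructions are the values of `f q` on truncations. By continuity they determine `f q`.
None is rejected: contradictory instructions with compatible arguments would, by monotonicity, give
`f q` two values at a common extension. -/
theorem exists_effOp_eq {f : List Bool → Code → Code} (hf : Computable₂ f)
    (hext : ∀ q (c d : Code), c.eval = d.eval → (f q c).eval = (f q d).eval) :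
    ∃ k, ∀ q c x, effOp (k, q, x) c = (f q c).eval x := by
  have hp : Partrec fun a : List Bool × ℕ × (Code × ℕ) =>
      (f a.1 (truncateCode a.2.2)).eval a.2.1 := by
    refine eval_part.comp (hf.comp Computable.fst ?_) (Computable.fst.comp Computable.snd)
    exact primrec_truncateCode.to_comp.comp (Computable.snd.comp Computable.snd)
  obtain ⟨κ, hκ⟩ := exists_eval_eq hp
  have hfq : ∀ q, Computable (f q) := fun q => hf.comp (Computable.const q) Computable.id
  have hval : ∀ q x i y, y ∈ instrVal (encode κ, q, x) i →
      y ∈ (f q (truncateCode (instrArg i))).eval x := by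
    intro q x i y hy
    have hy := evaln_sound hy
    rw [Denumerable.ofNat_encode, hκ] at hy
    simpa using hy
  refine ⟨encode κ, fun q c x => ?_⟩
  ext y
  rw [mem_effOp]
  constructor
  · rintro ⟨i, hy, -, hi⟩
    exact mem_eval_of_codeLe (hfq q) (hext q) hi (hval q x i y hy)
  · intro hy
    obtain ⟨n, hn⟩ := exists_mem_eval_truncateCode (hfq q) (hext q) hy
    have hy' : y ∈ κ.eval (encode (q, x, (c, n))) := by
      rw [hκ]
      simpa using hn
    obtain ⟨s, hs⟩ := exists_mem_evaln_iff.2 hy'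
    have hs' : y ∈ instrVal (encode κ, q, x) (Nat.pair s (encode (c, n))) := by
      rw [instrVal, instrArg_pair, Denumerable.ofNat_encode, Nat.unpair_pair]
      exact hs
    -- The index carries the step bound `s` needed to compute the value, together with the finite
    -- function `(c, n)`.
    refine ⟨Nat.pair s (encode (c, n)), hs', fun j _ => ?_, ?_⟩
    · cases hz : instrVal (encode κ, q, x) j with
      | none => simp
      | some z =>
        by_contra! h
        obtain ⟨d, hd1, hd2⟩ := exists_codeLe_of_compat h.2.2
        have h1 := mem_eval_of_codeLe (hfq q) (hext q) hd1 (hval q x _ y hs')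
        have h2 := mem_eval_of_codeLe (hfq q) (hext q) hd2 (hval q x j z hz)
        exact h.2.1 (by rw [Part.mem_unique h2 h1]; exact hs'.symm)
    · rw [instrArg_pair]
      exact codeLe_iff_of_truncate.2 fun a b hb => evaln_sound hb

theorem PR.exists_ofCode_eq (g : PR) : ∃ c, PR.ofCode c = g :=
  let ⟨c, hc⟩ := exists_code.1 g.2
  ⟨c, Subtype.ext hc⟩

theorem PR.ofCode_eq_iff {c d : Code} : PR.ofCode c = PR.ofCode d ↔ c.eval = d.eval :=
  Subtype.ext_iff

/-- Extensionality of a recursive `f` is not decidable. `effOp` avoids the question: every index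
yields an extensional operation, and an `f` that is already extensional is reproduced. -/
theorem exists_stronglyUniversal_effLang : ∃ U, StronglyUniversal EffLang U := by
  obtain ⟨h, hh, hhe⟩ := exists_primrec_code
    (g := fun (a : ℕ × List Bool × Code) (x : ℕ) => effOp (a.1, a.2.1, x) a.2.2) <| by
    have ha := Computable.fst (α := ℕ × List Bool × Code) (β := ℕ)
    exact partrec₂_effOp.comp ((Computable.fst.comp ha).pair
      ((Computable.fst.comp (Computable.snd.comp ha)).pair Computable.snd))
      (Computable.snd.comp (Computable.snd.comp ha))
  -- This choice of Goedel numbers is not computable, which does no harm since `effOp` depends only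
  -- on the function.
  choose code hcode using PR.exists_ofCode_eq
  have hev : ∀ c, (code (PR.ofCode c)).eval = c.eval := fun c => PR.ofCode_eq_iff.1 (hcode _)
  have hF : ∀ k q c, PR.ofCode (h (k, q, code (PR.ofCode c))) = PR.ofCode (h (k, q, c)) := by
    intro k q c
    rw [PR.ofCode_eq_iff, hhe, hhe]
    exact funext fun x => effOp_congr (hev c)
  refine exists_stronglyUniversal (fun k q g => PR.ofCode (h (k, q, code g))) ?_ fun V => ?_
  · refine ⟨fun w c => h ((splitWord w).1, (splitWord w).2, c), ?_, fun _ _ => hF _ _ _⟩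
    have := primrec_splitWord.comp (Primrec.fst (α := List Bool) (β := Code))
    exact (hh.comp ((Primrec.fst.comp this).pair
      ((Primrec.snd.comp this).pair Primrec.snd))).to_comp
  · constructor
    · rintro ⟨f, hf, hV⟩
      obtain ⟨k, hk⟩ := exists_effOp_eq hf fun q c d hcd => by
        rw [← PR.ofCode_eq_iff, ← hV, ← hV, PR.ofCode_eq_iff.2 hcd]
      refine ⟨k, funext fun q => funext fun g => ?_⟩
      obtain ⟨c, rfl⟩ := PR.exists_ofCode_eq g
      rw [hV, hF, PR.ofCode_eq_iff, hhe]
      exact funext fun x => hk q c x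
    · rintro ⟨k, rfl⟩
      exact ⟨fun q c => h (k, q, c), (hh.comp ((Primrec.const k).pair Primrec.id)).to_comp,
        fun q c => hF k q c⟩

/-! ### Church's representations and halting programs -/

theorem primrec₂_iterCode : Primrec₂ iterCode := by
  have h := Primrec.nat_rec' (Primrec.snd (α := Code) (β := ℕ)) (Primrec.const Code.id)
    (h := fun (a : Code × ℕ) (p : ℕ × Code) => Code.comp p.2 a.1)
    (primrec₂_comp.comp (Primrec.snd.comp Primrec.snd) (Primrec.fst.comp Primrec.fst))
  refine h.of_eq fun ⟨c, n⟩ => ?_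
  induction n with
  | zero => rfl
  | succ n ih => exact congrArg (fun d => Code.comp d c) ih

theorem iter_succ_apply (n x : ℕ) : iter Code.succ.eval n x = Part.some (x + n) := by
  induction n generalizing x with
  | zero => simp [iter]
  | succ n ih =>
    have h : iter Code.succ.eval (n + 1) x =
      (Code.succ.eval x).bind (iter Code.succ.eval n) := rfl
    have h' : Code.succ.eval x = Part.some (x + 1) := rfl
    rw [h, h']
    refine (Part.bind_some _ _).trans ?_
    rw [ih, Nat.add_right_comm, Nat.add_assoc]

/-- If the value of a halting program is `n`, one gets a Goedel number of the `n`-th iterate. -/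
theorem exists_iterCode_of_haltLang {V : List Bool → Part ℕ} (hV : HaltLang V) :
    ∃ h : List Bool → Code → Code, Computable₂ h ∧ ∀ p c x,
      (h p c).eval x = (V p).bind fun n => iter c.eval n x := by
  obtain ⟨h, hh, he⟩ := exists_primrec_code
    (g := fun (a : List Bool × Code) (x : ℕ) => (V a.1).bind fun n => (iterCode a.2 n).eval x) <| by
    refine Partrec.bind (hV.comp (Computable.fst.comp Computable.fst)) ?_
    exact eval_part.comp (primrec₂_iterCode.to_comp.comp
      (Computable.snd.comp (Computable.fst.comp Computable.fst)) Computable.snd)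
      (Computable.snd.comp Computable.fst)
  exact ⟨fun p c => h (p, c), hh.to_comp, fun p c x => by simp [he, eval_iterCode]⟩

theorem reduces_haltLang_codeLang :
    Reduces HaltLang haltOut CodeLang (fun F n => churchZCode F (n : ℤ)) := by
  intro V hV
  obtain ⟨h, hh, he⟩ := exists_iterCode_of_haltLang hV
  refine ⟨fun p c => PR.ofCode (h p c), ⟨h, hh, fun _ _ => rfl⟩, .of_forall fun p n hn c => ?_⟩
  funext x
  exact (he p c x).trans (by rw [Part.eq_some_iff.2 hn, Part.bind_some]; rfl)

/-- The `n`-th iterate of the successor takes the value `n` at `0`. -/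
theorem reduces_codeLang_haltLang :
    Reduces CodeLang (fun F n => churchZCode F (n : ℤ)) HaltLang haltOut := by
  rintro V ⟨f, hf, hV⟩
  refine ⟨fun p => (f p Code.succ).eval 0,
    eval_part.comp (hf.comp Computable.id (Computable.const _)) (Computable.const 0),
    .of_forall fun p n hn => ?_⟩
  have h : (f p Code.succ).eval = iter Code.succ.eval n := by
    have := hn Code.succ
    rw [hV] at this
    exact this
  simp [haltOut, h, iter_succ_apply]

/-- For nonnegative exponents `iterZ` depends only on the function, and every element of `PR` has a
Goedel number. -/
theorem churchZ_natCast_iff {F : PR → PR} {n : ℕ} : churchZ F (n : ℤ) ↔ churchN F n := by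
  refine ⟨fun h g => ?_, fun h c => h _⟩
  obtain ⟨c, rfl⟩ := PR.exists_ofCode_eq g
  exact h c

theorem KChurchZ_eq (E : List Bool → PR → PR) : KChurchZ E = KChurchN E := by
  funext n
  simp only [KChurchZ, KChurchN, complexity, churchZ_natCast_iff]

theorem reduces_haltLang_effLang : Reduces HaltLang haltOut EffLang churchN := by
  intro V hV
  obtain ⟨h, hh, he⟩ := exists_iterCode_of_haltLang hV
  choose code hcode using PR.exists_ofCode_eq
  refine ⟨fun p g => PR.ofCode (h p (code g)), ⟨h, hh, fun p c => ?_⟩,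
    .of_forall fun p n hn g => ?_⟩
  · rw [PR.ofCode_eq_iff]
    funext x
    rw [he, he, PR.ofCode_eq_iff.1 (hcode (PR.ofCode c))]
  · funext x
    refine (he p (code g) x).trans ?_
    rw [Part.eq_some_iff.2 hn, Part.bind_some]
    exact congrArg (fun g : PR => iter g.1 n x) (hcode g)

theorem reduces_effLang_haltLang : Reduces EffLang churchN HaltLang haltOut := by
  rintro V ⟨f, hf, hV⟩
  refine ⟨fun p => (f p Code.succ).eval 0,
    eval_part.comp (hf.comp Computable.id (Computable.const _)) (Computable.const 0),
    .of_forall fun p n hn => ?_⟩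
  have h : (f p Code.succ).eval = iter Code.succ.eval n := by
    have := hn (PR.ofCode Code.succ)
    rw [hV] at this
    exact this
  simp [haltOut, h, iter_succ_apply]

theorem Khalt_ne_top {U : List Bool → Part ℕ} (hU : Optimal HaltLang haltOut U) (n : ℕ) :
    Khalt U n ≠ ⊤ := by
  obtain ⟨c, hc⟩ := hU.2 (fun p => Part.some p.length) Computable.list_length
  refine ((hc n).trans_lt ?_).ne
  have : complexity haltOut (fun p => Part.some p.length) n ≤ (n : ℕ∞) := by
    simpa using complexity_le (ρ := haltOut) (U := fun p => Part.some p.length)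
      (p := List.replicate n true) (n := n) (by simp [haltOut])
  exact (add_le_add_left this (c : ℕ∞)).trans_lt (by exact_mod_cast ENat.natCast_lt_top (n + c))

/-! ### Stages of the enumeration of domains -/

section

variable {X : Type} [Primcodable X]

/-- The domains of the functions in an effective sequence are enumerated in stages. -/
theorem exists_stages {V : List Bool → X →. ℕ} (hV : FunLang V) :
    ∃ D : (List Bool × X) → ℕ → Prop, PrimrecRel D ∧ (∀ a s t, s ≤ t → D a s → D a t) ∧
      ∀ p x, x ∈ (V p).Dom ↔ ∃ s, D (p, x) s := by
  obtain ⟨c, hc⟩ := exists_eval_eq hV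
  refine ⟨fun a s => (evaln s c (encode a)).isSome, ?_, fun a s t => isSome_evaln_mono,
    fun p x => ?_⟩
  · refine PrimrecPred.of_eq (p := fun a : (List Bool × X) × ℕ =>
      (evaln a.2 c (encode a.1)).isSome = true) ?_ fun _ => Iff.rfl
    exact Primrec.eq.comp (Primrec.option_isSome.comp (primrec_evaln.comp
      ((Primrec.snd.pair (Primrec.const c)).pair (Primrec.encode.comp Primrec.fst))))
      (Primrec.const true)
  · rw [isSome_evaln_iff, hc]
    exact Iff.rfl

end

/-- The partial function that is defined where a computable predicate holds. -/
def domOf {X : Type} (b : List Bool → X → Bool) (p : List Bool) : X →. ℕ :=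
  fun x => ((bif b p x then some 0 else none : Option ℕ) : Part ℕ)

theorem funLang_domOf {X : Type} [Primcodable X] {b : List Bool → X → Bool} (hb : Computable₂ b) : FunLang (domOf b) :=
  Computable.ofOption (Computable.cond hb (Computable.const _) (Computable.const _))

theorem mem_dom_domOf {X : Type} {b : List Bool → X → Bool} {p : List Bool} {x : X} :
    x ∈ (domOf b p).Dom ↔ b p x = true := by
  rw [PFun.mem_dom]
  simp only [domOf, Part.mem_ofOption]
  cases b p x <;> simp

/-! ### Cardinals and infinite computations -/

theorem reduces_infLang_funLang : Reduces InfLang unaryOut (FunLang (X := ℕ)) cardN := by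
  intro V hV
  refine ⟨domOf V, funLang_domOf hV, .of_forall fun p n hn => ?_⟩
  have : (domOf V p).Dom = {t | V p t = true} := Set.ext fun x => mem_dom_domOf
  rwa [cardN, this]

/-- A symbol is output at time `Nat.pair x s` exactly when `s` is the first stage at which `x`
appears, so each element of the domain is counted once. -/
theorem reduces_funLang_infLang : Reduces (FunLang (X := ℕ)) cardN InfLang unaryOut := by
  classical
  intro V hV
  obtain ⟨D, hD, hmono, hdom⟩ := exists_stages hV
  have hW : PrimrecRel fun (p : List Bool) (t : ℕ) =>
      D (p, t.unpair.1) t.unpair.2 ∧ ∀ s < t.unpair.2, ¬D (p, t.unpair.1) s := by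
    have hx := (Primrec.fst (α := List Bool) (β := ℕ)).pair
      (Primrec.fst.comp (Primrec.unpair.comp Primrec.snd))
    have hs := Primrec.snd.comp (Primrec.unpair.comp (Primrec.snd (α := List Bool) (β := ℕ)))
    exact (hD.comp hx hs).and (primrecPred_forall_lt
      (R := fun s (a : List Bool × ℕ) => ¬D (a.1, a.2.unpair.1) s)
      (hD.comp (hx.comp Primrec.snd) Primrec.fst).not hs)
  refine ⟨_, hW.decide.to_comp, .of_forall fun p n hn => ?_⟩
  have himage : (fun t : ℕ => t.unpair.1) ''
      {t | D (p, t.unpair.1) t.unpair.2 ∧ ∀ s < t.unpair.2, ¬D (p, t.unpair.1) s} =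
      (V p).Dom := by
    ext x
    rw [hdom]
    constructor
    · rintro ⟨t, ht, rfl⟩
      exact ⟨_, ht.1⟩
    · exact fun h => ⟨Nat.pair x (Nat.find h), by
        rw [Set.mem_ofPred_eq, Nat.unpair_pair]
        exact ⟨Nat.find_spec h, fun s => Nat.find_min h⟩, by simp⟩
  rw [cardN, ← himage, Set.InjOn.encard_image] at hn
  · simpa only [unaryOut, decide_eq_true_eq] using hn
  · rintro t ⟨ht, ht'⟩ u ⟨hu, hu'⟩ (htu : t.unpair.1 = u.unpair.1)
    rw [← Nat.pair_unpair t, ← Nat.pair_unpair u, htu]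
    rw [htu] at ht ht'
    rw [le_antisymm (not_lt.1 fun h => ht' _ h hu) (not_lt.1 fun h => hu' _ h ht)]

/-! ### The limit lemma -/

/-- `a x t` is, for all sufficiently large `t`, a value of `f x`, if there is one. -/
def Approximates {α σ : Type} (a : α → ℕ → σ) (f : α →. σ) : Prop :=
  ∀ x, ∀ y ∈ f x, ∀ᶠ t in atTop, a x t = y

/-- The approximations are total and primitive recursive because nothing is required of them where
`f` is undefined. The same `t` bounds all subcomputations, and a convergent computation involves
only finitely many values, each of which stabilises. -/
theorem exists_approximates_nat {f : ℕ →. ℕ} (hf : Nat.RecursiveIn jumpOracle f) :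
    ∃ a : ℕ → ℕ → ℕ, Primrec₂ a ∧ Approximates a f := by
  have of_primrec : ∀ g : ℕ → ℕ, Primrec g → ∃ a : ℕ → ℕ → ℕ, Primrec₂ a ∧ Approximates a g :=
    fun g hg => ⟨fun x _ => g x, hg.comp Primrec.fst, fun x y hy => by
      rw [Part.mem_some_iff.1 hy]
      exact Eventually.of_forall fun _ => rfl⟩
  induction hf with
  | zero => exact of_primrec _ (Primrec.const 0)
  | succ => exact of_primrec _ Primrec.succ
  | left => exact of_primrec _ (Primrec.fst.comp Primrec.unpair)
  | right => exact of_primrec _ (Primrec.snd.comp Primrec.unpair)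
  | oracle g hg =>
    obtain rfl := Set.mem_singleton_iff.1 hg
    refine ⟨fun x t => bif (evaln t (Denumerable.ofNat Code x) x).isSome then 1 else 0,
      Primrec.cond (Primrec.option_isSome.comp (primrec_evaln.comp
        ((Primrec.snd.pair ((Primrec.ofNat Code).comp Primrec.fst)).pair Primrec.fst)))
        (Primrec.const 1) (Primrec.const 0), fun x y hy => ?_⟩
    rw [Part.mem_some_iff.1 hy]
    split_ifs with h
    · obtain ⟨s, hs⟩ := isSome_evaln_iff.2 h
      filter_upwards [eventually_ge_atTop s] with t ht
      rw [isSome_evaln_mono ht hs, cond_true]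
    · refine Eventually.of_forall fun t => ?_
      cases ht : (evaln t (Denumerable.ofNat Code x) x).isSome
      · simp only [ht, cond_false]
      · exact absurd (isSome_evaln_iff.1 ⟨t, ht⟩) h
  | @pair f g _ _ ihf ihg =>
    obtain ⟨a, ha, haf⟩ := ihf
    obtain ⟨b, hb, hbg⟩ := ihg
    refine ⟨fun x t => Nat.pair (a x t) (b x t), Primrec₂.natPair.comp ha hb, fun x y hy => ?_⟩
    simp only [Seq.seq, Part.map_eq_map, Part.mem_bind_iff, Part.mem_map_iff]
      at hy
    obtain ⟨_, ⟨u, hu, rfl⟩, v, hv, rfl⟩ := hy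
    filter_upwards [haf x u hu, hbg x v hv] with t h1 h2
    rw [h1, h2]
  | @comp f g _ _ ihf ihg =>
    obtain ⟨a, ha, haf⟩ := ihf
    obtain ⟨b, hb, hbg⟩ := ihg
    refine ⟨fun x t => a (b x t) t, ha.comp hb Primrec.snd, fun x y hy => ?_⟩
    obtain ⟨u, hu, hy⟩ := Part.mem_bind_iff.1 hy
    filter_upwards [hbg x u hu, haf u y hy] with t h1 h2
    rw [h1, h2]
  | @prec f g _ _ ihf ihg =>
    obtain ⟨a, ha, haf⟩ := ihf
    obtain ⟨b, hb, hbg⟩ := ihg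
    refine ⟨fun x t => Nat.rec (motive := fun _ => ℕ) (a x.unpair.1 t)
      (fun n i => b (Nat.pair x.unpair.1 (Nat.pair n i)) t) x.unpair.2, ?_, fun x => ?_⟩
    · refine Primrec.nat_rec' (f := fun p : ℕ × ℕ => p.1.unpair.2)
        (g := fun p : ℕ × ℕ => a p.1.unpair.1 p.2)
        (h := fun (p : ℕ × ℕ) (q : ℕ × ℕ) => b (Nat.pair p.1.unpair.1 (Nat.pair q.1 q.2)) p.2)
        (Primrec.snd.comp (Primrec.unpair.comp Primrec.fst))
        (ha.comp (Primrec.fst.comp (Primrec.unpair.comp Primrec.fst)) Primrec.snd) ?_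
      exact hb.comp (Primrec₂.natPair.comp
        (Primrec.fst.comp (Primrec.unpair.comp (Primrec.fst.comp Primrec.fst)))
        (Primrec₂.natPair.comp (Primrec.fst.comp Primrec.snd) (Primrec.snd.comp Primrec.snd)))
        (Primrec.snd.comp Primrec.fst)
    · dsimp only
      induction x.unpair.2 with
      | zero => exact haf _
      | succ n ih =>
        intro y hy
        obtain ⟨i, hi, hy⟩ := Part.mem_bind_iff.1 hy
        filter_upwards [ih i hi, hbg _ y hy] with t h1 h2
        rw [← h2, ← h1]
  | @rfind f _ ihf =>
    obtain ⟨a, ha, haf⟩ := ihf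
    -- An unsuccessful search below `t` returns `t`; this no longer happens once `t` exceeds the
    -- true value `y` and the approximations up to `y` are correct.
    refine ⟨fun x t => (List.range t).findIdx fun n => a (Nat.pair x n) t == 0, ?_,
      fun x y hy => ?_⟩
    · refine Primrec.list_findIdx (Primrec.list_range.comp Primrec.snd) ?_
      exact Primrec.beq.comp (ha.comp (Primrec₂.natPair.comp (Primrec.fst.comp Primrec.fst)
        Primrec.snd) (Primrec.snd.comp Primrec.fst)) (Primrec.const 0)
    · obtain ⟨h1, h2⟩ := Nat.mem_rfind.1 hy
      simp only [Part.map_eq_map, Part.mem_map_iff, decide_eq_true_eq, decide_eq_false_iff_not]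
        at h1 h2
      obtain ⟨_, h1, rfl⟩ := h1
      have h3 : ∀ᶠ t in atTop, ∀ m ∈ Set.Iio y, a (Nat.pair x m) t ≠ 0 := by
        rw [eventually_all_finite (Set.finite_Iio _)]
        intro m hm
        obtain ⟨v, hv, hv0⟩ := h2 hm
        filter_upwards [haf _ v hv] with t ht
        rwa [ht]
      filter_upwards [haf _ 0 h1, h3, eventually_gt_atTop y] with t h4 h5 h6
      rw [List.findIdx_eq (by simpa using h6)]
      simpa [h4] using h5

section

variable {α σ : Type} [Primcodable α] [Primcodable σ]

theorem exists_approximates {f : α →. σ} (hf : RecursiveIn jumpOracle f) :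
    ∃ a : α → ℕ → ℕ, Primrec₂ a ∧ Approximates a fun x => (f x).map encode := by
  obtain ⟨a, ha, haf⟩ := exists_approximates_nat hf
  refine ⟨fun x => a (encode x), ha.comp (Primrec.encode.comp Primrec.fst) Primrec.snd,
    fun x y hy => haf _ y ?_⟩
  simpa using hy

/-- `jump` only asks whether a program halts on its own number. For a program that ignores its input
this is an arbitrary halting question. -/
theorem encode_mem_jump_iff {c : Code} {x : ℕ} {g : ℕ →. ℕ} (hc : c.eval = g)
    (hg : ∀ n, g n = g x) : encode c ∈ jump ↔ (g x).Dom := by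
  have : encode c ∈ jump ↔ ((Denumerable.ofNat Code (encode c)).eval (encode c)).Dom := Iff.rfl
  rw [this, Denumerable.ofNat_encode, hc, hg]

open Classical in
/-- The oracle decides enumerable predicates. -/
theorem exists_oracle_query {R : α → ℕ → Bool} (hR : Computable₂ R) :
    ∃ H : ℕ →. ℕ, Nat.RecursiveIn jumpOracle H ∧
      ∀ m, H m = Part.bind (decode (α := α) m) fun x =>
        Part.some (if ∃ u, R x u = true then 1 else 0) := by
  have hp : Partrec₂ fun (x : α) (_ : ℕ) => Nat.rfind fun u => (Part.some (R x u)) :=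
    Partrec.rfind (hR.comp (Computable.fst.comp Computable.fst) Computable.snd)
  obtain ⟨h, hh, he⟩ := exists_primrec_code hp
  have hH : Nat.Partrec fun n => Part.bind (decode (α := α) n) fun p =>
      (Part.some (h p)).map encode := hh.to_comp
  refine ⟨_, .comp (.oracle _ (Set.mem_singleton _)) hH.recursiveIn, fun m => ?_⟩
  cases hm : decode (α := α) m with
  | none => simp
  | some x =>
    simp only [Part.coe_some, Part.bind_some, Part.map_some, Part.bind_eq_bind]
    congr 2
    rw [encode_mem_jump_iff (x := 0) (he x) fun _ => rfl]
    exact propext (Nat.rfind_dom'.trans (by simp))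

/-- A function that is the limit of a computable sequence is recursive in `∅'`. -/
theorem recursiveIn_of_limit {a : α → ℕ → σ} (ha : Computable₂ a) {f : α →. σ}
    (hf : ∀ x y, y ∈ f x ↔ ∀ᶠ t in atTop, a x t = y) : RecursiveIn jumpOracle f := by
  classical
  -- The query at `(x, s)` asks whether the sequence takes, after stage `s`, a value other than `a x
  -- s`.
  have hR : Computable₂ fun (p : α × ℕ) (u : ℕ) =>
      !decide (encode (a p.1 (p.2 + u)) = encode (a p.1 p.2)) := by
    have hx := Computable.fst.comp (Computable.fst (α := α × ℕ) (β := ℕ))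
    have hs := Computable.snd.comp (Computable.fst (α := α × ℕ) (β := ℕ))
    refine Primrec.not.to_comp.comp (Primrec.eq.decide.to_comp.comp ?_ ?_)
    · exact Computable.encode.comp (ha.comp hx (Primrec.nat_add.to_comp.comp hs Computable.snd))
    · exact Computable.encode.comp (ha.comp hx hs)
  obtain ⟨H, hH, hHe⟩ := exists_oracle_query hR
  have hA : Nat.Partrec fun n => Part.bind (decode (α := α × ℕ) n) fun p : α × ℕ =>
      (Part.some (a p.1 p.2)).map encode := ha
  -- `rfind` stops at the first stage where the oracle answers `0`, meaning no later change; the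
  -- sequence is then evaluated there.
  refine (((hA.recursiveIn).comp (.pair (Nat.Partrec.some.recursiveIn) hH.rfind)).of_eq
    fun m => ?_ : Nat.RecursiveIn _ _)
  ext v
  simp only [hHe, Part.bind_eq_bind, Part.mem_bind_iff, Part.map_eq_map, Seq.seq,
    Part.mem_map_iff, Part.mem_some_iff, exists_eq_left, Part.mem_ofOption]
  cases hm : decode (α := α) m with
  | none =>
    simp [hm]
  | some x =>
    suffices (∃ s ∈ Nat.rfind fun n => Part.some (decide (∀ u, a x (n + u) = a x n)),
        encode (a x s) = v) ↔ ∃ y ∈ f x, encode y = v by simpa [hm] using this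
    have key : ∀ s, s ∈ (Nat.rfind fun n => Part.some (decide (∀ u, a x (n + u) = a x n))) →
        ∀ᶠ t in atTop, a x t = a x s := by
      intro s hs
      have h1 : ∀ u, a x (s + u) = a x s := by simpa using Nat.rfind_spec hs
      filter_upwards [eventually_ge_atTop s] with t ht
      rw [← h1 (t - s), Nat.add_sub_cancel' ht]
    constructor
    · rintro ⟨s, hs, rfl⟩
      exact ⟨a x s, (hf x _).2 (key s hs), rfl⟩
    · rintro ⟨y, hy, rfl⟩
      obtain ⟨N, hN⟩ := eventually_atTop.1 ((hf x y).1 hy)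
      have hd : (Nat.rfind fun n => Part.some (decide (∀ u, a x (n + u) = a x n))).Dom :=
        Nat.rfind_dom'.2 ⟨N, by
          simpa using fun u => (hN (N + u) (by omega)).trans (hN N le_rfl).symm, by simp⟩
      refine ⟨_, Part.get_mem hd, ?_⟩
      obtain ⟨t, h1, h2⟩ := ((key _ (Part.get_mem hd)).and ((hf x y).1 hy)).exists
      rw [← h1, h2]

end

/-! ### Languages with oracle `∅'` -/

/-- The limit of a sequence in a discrete space, if there is one. -/
def limPart {σ : Type} (a : ℕ → σ) : Part σ :=
  ⟨∃ y, ∀ᶠ t in atTop, a t = y, fun h => h.choose⟩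

theorem mem_limPart {σ : Type} {a : ℕ → σ} {y : σ} :
    y ∈ limPart a ↔ ∀ᶠ t in atTop, a t = y := by
  constructor
  · rintro ⟨h, rfl⟩
    exact h.choose_spec
  · intro h
    have hd : ∃ y, ∀ᶠ t in atTop, a t = y := ⟨y, h⟩
    obtain ⟨t, h1, h2⟩ := (hd.choose_spec.and h).exists
    exact ⟨hd, h1.symm.trans h2⟩

theorem haltLangJump_limPart {a : List Bool → ℕ → ℕ} (ha : Computable₂ a) :
    HaltLangJump fun p => limPart (a p) :=
  recursiveIn_of_limit ha fun _ _ => mem_limPart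

theorem exists_approximates_haltLangJump {V : List Bool → Part ℕ} (hV : HaltLangJump V) :
    ∃ a : List Bool → ℕ → ℕ, Primrec₂ a ∧ Approximates a V := by
  obtain ⟨a, ha, haV⟩ := exists_approximates hV
  exact ⟨a, ha, fun p n hn => haV p n (by simpa using hn)⟩

theorem infLangJump_of_limit {a : List Bool × ℕ → ℕ → Bool} (ha : Computable₂ a)
    {V : List Bool → ℕ → Bool} (h : ∀ p t, ∀ᶠ s in atTop, a (p, t) s = V p t) :
    InfLangJump V := by
  refine recursiveIn_of_limit ha fun x y => ?_
  rw [Part.mem_some_iff]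
  constructor
  · rintro rfl
    exact h x.1 x.2
  · intro hy
    obtain ⟨s, h1, h2⟩ := (hy.and (h x.1 x.2)).exists
    exact h1.symm.trans h2

theorem exists_approximates_infLangJump {V : List Bool → ℕ → Bool} (hV : InfLangJump V) :
    ∃ a : List Bool → ℕ → ℕ → Bool, Primrec (fun x : (List Bool × ℕ) × ℕ => a x.1.1 x.1.2 x.2) ∧
      ∀ p t, ∀ᶠ s in atTop, a p t s = V p t := by
  obtain ⟨a, ha, haV⟩ := exists_approximates hV
  refine ⟨fun p t s => a (p, t) s == encode true, ?_, fun p t => ?_⟩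
  · exact Primrec.beq.comp ha (Primrec.const _)
  · filter_upwards [haV (p, t) (encode (V p t)) (by simp)] with s hs
    simp only [hs]
    cases V p t <;> simp

open Classical in
/-- Co-enumerable predicates give languages with oracle `∅'`. -/
theorem infLangJump_of_forall {R : List Bool × ℕ → ℕ → Prop} (hR : PrimrecRel R) :
    InfLangJump fun p t => decide (∀ u, R (p, t) u) := by
  have ha : PrimrecRel fun (x : List Bool × ℕ) (s : ℕ) => ∀ u < s, R x u :=
    primrecPred_forall_lt (R := fun u (y : (List Bool × ℕ) × ℕ) => R y.1 u)
      (hR.comp (Primrec.fst.comp Primrec.snd) Primrec.fst) Primrec.snd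
  refine infLangJump_of_limit ha.decide.to_comp fun p t => ?_
  by_cases h : ∀ u, R (p, t) u
  · exact Eventually.of_forall fun s => by simp [h]
  · obtain ⟨u, hu⟩ := not_forall.1 h
    filter_upwards [eventually_gt_atTop u] with s hs
    rw [decide_eq_decide]
    exact iff_of_false (fun h' => hu (h' u hs)) h

/-! ### Counting the elements of an enumerated set -/

open Classical in
/-- The number of elements below `s` that have been enumerated at stage `s`. -/
def stageCount (E : ℕ → ℕ → Prop) (s : ℕ) : ℕ := ((List.range s).filter fun x => E x s).length

theorem primrec_stageCount {α : Type} [Primcodable α] {D : α × ℕ → ℕ → Prop} (hD : PrimrecRel D) :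
    Primrec₂ fun (a : α) (s : ℕ) => stageCount (fun x => D (a, x)) s := by
  classical
  have h : PrimrecRel fun (x : ℕ) (p : α × ℕ) => D (p.1, x) p.2 :=
    hD.comp ((Primrec.fst.comp Primrec.snd).pair Primrec.fst) (Primrec.snd.comp Primrec.snd)
  exact (Primrec.list_length.comp
    (h.listFilter.comp (Primrec.list_range.comp Primrec.snd) Primrec.id)).of_eq fun p => by
      simp only [stageCount, id]

open Classical in
theorem stageCount_eq (E : ℕ → ℕ → Prop) (s : ℕ) :
    stageCount E s = ((Finset.range s).filter fun x => E x s).card := by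
  rfl

section

variable {E : ℕ → ℕ → Prop} (hE : ∀ x s t, s ≤ t → E x s → E x t)
include hE

theorem stageCount_mono : Monotone (stageCount E) := by
  classical
  intro s t hst
  rw [stageCount_eq, stageCount_eq]
  refine Finset.card_le_card fun x hx => ?_
  simp only [Finset.mem_filter, Finset.mem_range] at hx ⊢
  exact ⟨hx.1.trans_le hst, hE x s t hst hx.2⟩

theorem eventually_stageCount_eq {A : Finset ℕ} (hA : ∀ x, x ∈ A ↔ ∃ s, E x s) :
    ∀ᶠ s in atTop, stageCount E s = A.card := by
  classical
  have h : ∀ᶠ s in atTop, ∀ x ∈ A, x < s ∧ E x s := by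
    rw [eventually_all_finset]
    intro x hx
    obtain ⟨s, hs⟩ := (hA x).1 hx
    filter_upwards [eventually_gt_atTop x, eventually_ge_atTop s] with t h1 h2
    exact ⟨h1, hE x s t h2 hs⟩
  filter_upwards [h] with s hs
  rw [stageCount_eq]
  congr 1
  ext x
  simp only [Finset.mem_filter, Finset.mem_range]
  exact ⟨fun hx => (hA x).2 ⟨s, hx.2⟩, hs x⟩

/-- An infinite set would contain `n + 1` elements, all counted from some stage on. -/
theorem encard_eq_of_eventually {n : ℕ} (hn : ∀ᶠ s in atTop, stageCount E s = n) :
    {x | ∃ s, E x s}.encard = n := by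
  classical
  have hfin : {x | ∃ s, E x s}.Finite := by
    by_contra hinf
    obtain ⟨B, hB, hBn⟩ := Set.Infinite.exists_subset_card_eq hinf (n + 1)
    have h := eventually_stageCount_eq (E := fun x s => x ∈ B ∧ E x s) (A := B)
      (fun x s t hst h => ⟨h.1, hE x s t hst h.2⟩)
      fun x => ⟨fun hx => (hB hx).imp fun s hs => ⟨hx, hs⟩, fun ⟨_, hx⟩ => hx.1⟩
    obtain ⟨s, h1, h2⟩ := (h.and hn).exists
    rw [stageCount_eq] at h1 h2
    have : B.card ≤ n := by
      rw [← h1, ← h2]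
      refine Finset.card_le_card fun x hx => ?_
      simp only [Finset.mem_filter] at hx ⊢
      exact ⟨hx.1, hx.2.2⟩
    omega
  obtain ⟨s, h1, h2⟩ := (hn.and (eventually_stageCount_eq hE (A := hfin.toFinset)
    fun x => by simp)).exists
  rw [hfin.encard_eq_coe_toFinset_card, ← h2, h1]

/-- The count is monotone: either it exceeds `n` for good, or it never does and one visit to `n`
fixes it there. The equivalence also covers infinite sets, for which the count eventually leaves
every `n`. -/
theorem eventually_stageCount_eq_iff (n : ℕ) :
    ∀ᶠ s in atTop, (stageCount E s = n ↔ {x | ∃ s, E x s}.encard = n) := by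
  by_cases h : {x | ∃ s, E x s}.encard = n
  · have hfin := Set.finite_of_encard_eq_coe h
    filter_upwards [eventually_stageCount_eq hE (A := hfin.toFinset) fun x => by simp] with s hs
    rw [hfin.encard_eq_coe_toFinset_card, ← hs, Nat.cast_inj]
  · simp only [h, iff_false]
    by_contra hf
    refine h (encard_eq_of_eventually hE ?_)
    by_cases hlt : ∃ s, n < stageCount E s
    · obtain ⟨s, hs⟩ := hlt
      refine absurd ?_ hf
      filter_upwards [eventually_ge_atTop s] with t ht
      exact (hs.trans_le (stageCount_mono hE ht)).ne'
    · push Not at hlt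
      obtain ⟨s, hs⟩ := (not_eventually.1 hf).exists
      filter_upwards [eventually_ge_atTop s] with t ht
      exact le_antisymm (hlt t) (not_not.1 hs ▸ stageCount_mono hE ht)

end

/-- The number of elements of the domains of the functions in an effective sequence is
approximated by primitive recursive functions. -/
theorem exists_count {V : List Bool → ℕ →. ℕ} (hV : FunLang V) :
    ∃ a : List Bool → ℕ → ℕ, Primrec₂ a ∧
      ∀ p n, ∀ᶠ s in atTop, (a p s = n ↔ (V p).Dom.encard = n) := by
  obtain ⟨D, hD, hmono, hdom⟩ := exists_stages hV
  refine ⟨fun p => stageCount fun x => D (p, x), primrec_stageCount hD, fun p n => ?_⟩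
  have h : (V p).Dom = {x | ∃ s, D (p, x) s} := Set.ext fun x => hdom p x
  rw [h]
  exact eventually_stageCount_eq_iff (fun x => hmono (p, x)) n

/-! ### Cardinals, integer cardinals, and halting computations with oracle `∅'` -/

theorem reduces_funLang_haltLangJump :
    Reduces (FunLang (X := ℕ)) cardN HaltLangJump haltOut := by
  intro V hV
  obtain ⟨a, ha, haV⟩ := exists_count hV
  refine ⟨_, haltLangJump_limPart ha.to_comp, .of_forall fun p n hn => mem_limPart.2 ?_⟩
  filter_upwards [haV p n] with s hs
  exact hs.2 hn

theorem reduces_pairLang_haltLangJump : Reduces PairLang (fun q n => cardZ q (n : ℤ))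
    HaltLangJump haltOut := by
  rintro V ⟨hV₁, hV₂⟩
  obtain ⟨a, ha, haV⟩ := exists_count hV₁
  obtain ⟨b, hb, hbV⟩ := exists_count hV₂
  -- Truncated subtraction gives the right limit because the number named is nonnegative.
  refine ⟨_, haltLangJump_limPart (a := fun p s => a p s - b p s)
    (Primrec.nat_sub.comp ha hb).to_comp,
    .of_forall fun p n hn => mem_limPart.2 ?_⟩
  obtain ⟨h1, h2, h3⟩ := hn
  filter_upwards [haV p (V p).1.Dom.ncard, hbV p (V p).2.Dom.ncard] with s hs ht
  rw [hs.2 h1.cast_ncard_eq.symm, ht.2 h2.cast_ncard_eq.symm]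
  omega

/-- The set consists of the coded pairs `(t, i)` with `i < d t`: it turns a sum of increments into a
cardinal. -/
theorem finite_and_ncard_eq_sum {d : ℕ → ℕ} {T : ℕ} (hd : ∀ t, T ≤ t → d t = 0) :
    {m : ℕ | m.unpair.2 < d m.unpair.1}.Finite ∧
      {m : ℕ | m.unpair.2 < d m.unpair.1}.ncard = ∑ t ∈ Finset.range T, d t := by
  classical
  have h : {m : ℕ | m.unpair.2 < d m.unpair.1} =
      (((Finset.range T).sigma fun t => Finset.range (d t)).image
        fun q : (_ : ℕ) × ℕ => Nat.pair q.1 q.2 : Finset ℕ) := by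
    ext m
    simp only [Set.mem_ofPred_eq, Finset.coe_image, Set.mem_image, Finset.mem_coe,
      Finset.mem_sigma, Finset.mem_range]
    constructor
    · intro hm
      refine ⟨⟨m.unpair.1, m.unpair.2⟩, ⟨?_, hm⟩, Nat.pair_unpair m⟩
      by_contra hT
      rw [hd _ (not_lt.1 hT)] at hm
      omega
    · rintro ⟨q, ⟨-, hq⟩, rfl⟩
      simpa using hq
  rw [h]
  refine ⟨Finset.finite_toSet _, ?_⟩
  rw [Set.ncard_coe_finset, Finset.card_image_of_injective, Finset.card_sigma]
  · simp
  · rintro ⟨x, y⟩ ⟨u, v⟩ hq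
    obtain ⟨rfl, rfl⟩ := Nat.pair_eq_pair.1 hq
    rfl

theorem sum_sub_sum_sub (b : ℕ → ℕ) (T : ℕ) :
    ((∑ t ∈ Finset.range T, (b (t + 1) - b t) : ℕ) : ℤ) -
      ((∑ t ∈ Finset.range T, (b t - b (t + 1)) : ℕ) : ℤ) = b T - b 0 := by
  induction T with
  | zero => simp
  | succ T ih =>
    rw [Finset.sum_range_succ, Finset.sum_range_succ]
    omega

/-- One domain collects the increases of the approximation, the other its decreases. Both are finite
once the approximation is constant, and their difference telescopes to the limit. -/
theorem reduces_haltLangJump_pairLang : Reduces HaltLangJump haltOut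
    PairLang (fun q n => cardZ q (n : ℤ)) := by
  intro V hV
  obtain ⟨a, ha, haV⟩ := exists_approximates_haltLangJump hV
  -- Putting a `0` in front of the sequence makes the telescoping sum equal to the limit itself.
  obtain ⟨b, hb, hb0, hb1⟩ : ∃ b : List Bool → ℕ → ℕ, Primrec₂ b ∧ (∀ p, b p 0 = 0) ∧
      ∀ p t, b p (t + 1) = a p t :=
    ⟨fun p t => Nat.casesOn (motive := fun _ => ℕ) t 0 fun u => a p u, Primrec.nat_casesOn
      (h := fun (q : List Bool × ℕ) u => a q.1 u) Primrec.snd (Primrec.const 0)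
      (ha.comp (Primrec.fst.comp Primrec.fst) Primrec.snd).to₂, fun _ => rfl, fun _ _ => rfl⟩
  have hp := Primrec.fst (α := List Bool) (β := ℕ)
  have ht := Primrec.fst.comp (Primrec.unpair.comp (Primrec.snd (α := List Bool) (β := ℕ)))
  have hi := Primrec.snd.comp (Primrec.unpair.comp (Primrec.snd (α := List Bool) (β := ℕ)))
  have h0 := hb.comp hp ht
  have h1 := hb.comp hp (Primrec.succ.comp ht)
  have hf : Computable₂ fun (p : List Bool) (m : ℕ) =>
      decide (m.unpair.2 < b p (m.unpair.1 + 1) - b p m.unpair.1) :=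
    (Primrec.nat_lt.decide.comp hi (Primrec.nat_sub.comp h1 h0)).to_comp
  have hg : Computable₂ fun (p : List Bool) (m : ℕ) =>
      decide (m.unpair.2 < b p m.unpair.1 - b p (m.unpair.1 + 1)) :=
    (Primrec.nat_lt.decide.comp hi (Primrec.nat_sub.comp h0 h1)).to_comp
  refine ⟨fun p =>
      (domOf (fun p m => decide (m.unpair.2 < b p (m.unpair.1 + 1) - b p m.unpair.1)) p,
        domOf (fun p m => decide (m.unpair.2 < b p m.unpair.1 - b p (m.unpair.1 + 1))) p), ⟨funLang_domOf hf, funLang_domOf hg⟩,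
    .of_forall fun p n hn => ?_⟩
  obtain ⟨T, hT⟩ := eventually_atTop.1 (haV p n hn)
  have hbT : ∀ t, T + 1 ≤ t → b p t = n := fun t ht => by
    obtain ⟨u, rfl⟩ : ∃ u, t = u + 1 := ⟨t - 1, by omega⟩
    rw [hb1, hT u (by omega)]
  obtain ⟨f1, c1⟩ := finite_and_ncard_eq_sum (d := fun t => b p (t + 1) - b p t) (T := T + 1)
    fun t ht => by rw [hbT t ht, hbT (t + 1) (by omega), Nat.sub_self]
  obtain ⟨f2, c2⟩ := finite_and_ncard_eq_sum (d := fun t => b p t - b p (t + 1)) (T := T + 1)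
    fun t ht => by rw [hbT t ht, hbT (t + 1) (by omega), Nat.sub_self]
  have hdom : ∀ g : List Bool → ℕ → Bool, (domOf g p).Dom = {m | g p m = true} :=
    fun g => Set.ext fun m => mem_dom_domOf
  simp only [cardZ, hdom, decide_eq_true_eq]
  refine ⟨f1, f2, ?_⟩
  have := sum_sub_sum_sub (b p) (T + 1)
  rw [hbT (T + 1) le_rfl] at this
  rw [c1, c2, this, hb0]
  simp

/-! ### Sums over all short programs -/

/-- The word with the given code. -/
def wordAt (m : ℕ) : List Bool := (decode m).getD []

theorem primrec_wordAt : Primrec wordAt :=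
  Primrec.option_getD.comp Primrec.decode (Primrec.const _)

/-- `m` codes a pair of a word of length at most `k` and a number. -/
def ShortPair (k m : ℕ) : Prop :=
  encode (wordAt m.unpair.1) = m.unpair.1 ∧ (wordAt m.unpair.1).length ≤ k

theorem primrecRel_shortPair : PrimrecRel ShortPair := by
  have h := Primrec.fst.comp (Primrec.unpair.comp (Primrec.snd (α := ℕ) (β := ℕ)))
  exact (Primrec.eq.comp (Primrec.encode.comp (primrec_wordAt.comp h)) h).and
    (Primrec.nat_le.comp (Primrec.list_length.comp (primrec_wordAt.comp h)) Primrec.fst)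

/-- The disjoint union of finite sets indexed by the words of length at most `k` is finite, and has
at least as many elements as each of them. -/
theorem exists_encard_eq {A : List Bool → Set ℕ} (hA : ∀ p, (A p).Finite) (k : ℕ) :
    ∃ n : ℕ, {m : ℕ | ShortPair k m ∧ m.unpair.2 ∈ A (wordAt m.unpair.1)}.encard = n ∧
      ∀ p : List Bool, p.length ≤ k → (A p).encard ≤ n := by
  set M := {m : ℕ | ShortPair k m ∧ m.unpair.2 ∈ A (wordAt m.unpair.1)} with hM
  have hinj : ∀ p : List Bool, Function.Injective fun i => Nat.pair (encode p) i :=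
    fun p i j hij => (Nat.pair_eq_pair.1 hij).2
  have hfin : M.Finite := by
    refine ((List.finite_length_le Bool k).biUnion
      fun p _ => (hA p).image fun i => Nat.pair (encode p) i).subset fun m hm => ?_
    simp only [Set.mem_iUnion]
    exact ⟨wordAt m.unpair.1, hm.1.2, m.unpair.2, hm.2, by
      dsimp only
      rw [hm.1.1, Nat.pair_unpair]⟩
  refine ⟨M.ncard, hfin.cast_ncard_eq.symm, fun p hp => ?_⟩
  rw [hfin.cast_ncard_eq, ← (hinj p).encard_image]
  refine Set.encard_le_encard ?_
  rintro _ ⟨i, hi, rfl⟩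
  simpa [hM, ShortPair, wordAt] using ⟨hp, hi⟩

/-! ### Halting computations and cardinals -/

theorem cardN_iff {f : ℕ →. ℕ} {n : ℕ} {S : Set ℕ} (h : ∀ x, (∃ y, y ∈ f x) ↔ x ∈ S) :
    cardN f n ↔ S.encard = n := by
  have : f.Dom = S := Set.ext fun x => (PFun.mem_dom f x).trans (h x)
  rw [cardN, this]

theorem reduces_haltLang_funLang : Reduces HaltLang haltOut (FunLang (X := ℕ)) cardN := by
  intro V hV
  refine ⟨fun p x => (V p).bind fun n => ((if x < n then some 0 else none : Option ℕ) : Part ℕ),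
    ?_, .of_forall fun p n hn => ?_⟩
  · refine Partrec.bind (hV.comp Computable.fst) (Computable.ofOption (Primrec.to_comp ?_))
    exact Primrec.ite (Primrec.nat_lt.comp (Primrec.snd.comp Primrec.fst) Primrec.snd)
      (Primrec.const _) (Primrec.const _)
  · refine (cardN_iff (S := Set.Iio n) fun x => ?_).2 ?_
    · simp only [Part.eq_some_iff.2 hn, Part.bind_some, Part.mem_ofOption]
      simp
    · rw [← Finset.coe_Iio, Set.encard_coe_eq_coe_finsetCard, Nat.card_Iio]

/-- The domain of `W p` is the disjoint union of the sets `{0, …, v}` over the outputs `v` of the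
programs of length at most `2 * |p|`. It is enumerable, and has at least `v + 1` elements for each
such `v`. -/
theorem exists_funLang_haltLang_gap {U : List Bool → Part ℕ} (hU : HaltLang U) :
    ∃ W, FunLang (X := ℕ) W ∧ ∀ p, ∃ n, cardN (W p) n ∧
      ∀ q, haltOut (U q) n → 2 * p.length < q.length := by
  classical
  refine ⟨fun p m => (U (wordAt m.unpair.1)).bind fun v =>
    ((if ShortPair (2 * p.length) m ∧ m.unpair.2 ≤ v then some 0 else none : Option ℕ) : Part ℕ),
    ?_, fun p => ?_⟩
  · have hm := Primrec.unpair.comp (Primrec.snd (α := List Bool) (β := ℕ))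
    refine Partrec.bind (hU.comp (primrec_wordAt.comp (Primrec.fst.comp hm)).to_comp)
      (Computable.ofOption (Primrec.to_comp ?_))
    refine Primrec.ite (PrimrecPred.and (primrecRel_shortPair.comp (Primrec.nat_mul.comp
      (Primrec.const 2) (Primrec.list_length.comp (Primrec.fst.comp Primrec.fst)))
      (Primrec.snd.comp Primrec.fst)) (Primrec.nat_le.comp ?_ Primrec.snd))
      (Primrec.const _) (Primrec.const _)
    exact Primrec.snd.comp (hm.comp Primrec.fst)
  · obtain ⟨n, hn, hle⟩ := exists_encard_eq (A := fun q => {i | ∃ v ∈ U q, i ≤ v})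
      (fun q => by
        by_cases hd : (U q).Dom
        · refine (Set.finite_Iic ((U q).get hd)).subset ?_
          rintro i ⟨v, hv, hi⟩
          rwa [Set.mem_Iic, Part.get_eq_of_mem hv hd]
        · refine Set.finite_empty.subset ?_
          rintro i ⟨v, hv, -⟩
          exact absurd (Part.dom_iff_mem.2 ⟨v, hv⟩) hd) (2 * p.length)
    refine ⟨n, ?_, fun q hq => ?_⟩
    · refine (cardN_iff fun m => ?_).2 hn
      simp only [Part.mem_bind_iff, Part.mem_ofOption, Option.mem_def,
        Option.ite_none_right_eq_some, Set.mem_ofPred_eq]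
      constructor
      · rintro ⟨_, v, hv, ⟨h1, h2⟩, -⟩
        exact ⟨h1, v, hv, h2⟩
      · rintro ⟨h1, v, hv, h2⟩
        exact ⟨0, v, hv, ⟨h1, h2⟩, rfl⟩
    · by_contra! hlt
      have h1 := hle q hlt
      have h2 : Set.Iic n ⊆ {i | ∃ v ∈ U q, i ≤ v} := fun i hi => ⟨n, hq, hi⟩
      have h3 := (Set.encard_le_encard h2).trans h1
      rw [← Finset.coe_Iic, Set.encard_coe_eq_coe_finsetCard, Nat.card_Iic, Nat.cast_le] at h3
      omega

/-! ### A number that is the cardinal of no short program -/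

/-- All words of length at most `k`. -/
def wordsUpTo : ℕ → List (List Bool)
  | 0 => [[]]
  | k + 1 => [] :: (wordsUpTo k).flatMap fun w => [true :: w, false :: w]

theorem mem_wordsUpTo {k : ℕ} {w : List Bool} : w ∈ wordsUpTo k ↔ w.length ≤ k := by
  induction k generalizing w with
  | zero => simp [wordsUpTo]
  | succ k ih =>
    rcases w with - | ⟨b, w⟩
    · simp [wordsUpTo]
    · cases b <;> simp [wordsUpTo, ih]

theorem primrec_wordsUpTo : Primrec wordsUpTo := by
  refine (Primrec.nat_rec₁ [[]] (f := fun _ (l : List (List Bool)) =>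
    [] :: l.flatMap fun w => [true :: w, false :: w]) ?_).of_eq fun k => ?_
  · refine Primrec.list_cons.comp (Primrec.const []) (Primrec.list_flatMap Primrec.snd ?_)
    exact Primrec.list_cons.comp (Primrec.list_cons.comp (Primrec.const true) Primrec.snd)
      (Primrec.list_cons.comp (Primrec.list_cons.comp (Primrec.const false) Primrec.snd)
        (Primrec.const []))
  · induction k with
    | zero => rfl
    | succ k ih => simp only [wordsUpTo, ← ih]

/-- `W p` is the least number that is not the cardinal of a domain named by a word of length at most
`2 * |p|`. It is the limit of the least numbers avoided by the counts at stage `s`. -/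
theorem exists_haltLangJump_funLang_gap {P : List Bool → ℕ →. ℕ} (hP : FunLang P) :
    ∃ W, HaltLangJump W ∧ ∀ p, ∃ n, haltOut (W p) n ∧
      ∀ q, cardN (P q) n → 2 * p.length < q.length := by
  classical
  obtain ⟨c, hc, hcP⟩ := exists_count hP
  have hR : PrimrecRel fun (n : ℕ) (x : List Bool × ℕ) =>
      ∀ w ∈ wordsUpTo (2 * x.1.length), c w x.2 ≠ n := by
    have h : PrimrecRel fun (w : List Bool) (y : ℕ × (List Bool × ℕ)) => c w y.2.2 ≠ y.1 :=
      (Primrec.eq.comp (hc.comp Primrec.fst (Primrec.snd.comp (Primrec.snd.comp Primrec.snd)))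
        (Primrec.fst.comp Primrec.snd)).not
    exact h.forall_mem_list.comp (primrec_wordsUpTo.comp (Primrec.nat_mul.comp (Primrec.const 2)
      (Primrec.list_length.comp (Primrec.fst.comp Primrec.snd)))) Primrec.id
  have hd := @PrimrecRel.decide _ _ _ _ _ (fun _ _ => Classical.propDecidable _) hR
  have ha : Primrec₂ fun (p : List Bool) (s : ℕ) => (List.range s).findIdx fun n =>
      decide (∀ w ∈ wordsUpTo (2 * p.length), c w s ≠ n) :=
    Primrec.list_findIdx (Primrec.list_range.comp Primrec.snd)
      (hd.comp Primrec.snd Primrec.fst).to₂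
  refine ⟨_, haltLangJump_limPart ha.to_comp, fun p => ?_⟩
  set L := wordsUpTo (2 * p.length)
  have hex : ∃ n : ℕ, ∀ w ∈ L, (P w).Dom.encard ≠ n := by
    have hfin : {n : ℕ | ∃ w ∈ L, (P w).Dom.encard = n}.Finite := by
      refine (((List.finite_toSet L).image fun w => (P w).Dom.encard.toNat)).subset ?_
      rintro n ⟨w, hw, hn⟩
      exact ⟨w, hw, by simp [hn]⟩
    obtain ⟨n, hn⟩ := hfin.infinite_compl.nonempty
    exact ⟨n, fun w hw h => hn ⟨w, hw, h⟩⟩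
  refine ⟨Nat.find hex, mem_limPart.2 ?_, fun q hq => ?_⟩
  -- Finitely many pairs `(n, w)` matter, so their counts are all correct from some stage on.
  · have h1 : ∀ᶠ s in atTop, ∀ n ∈ Set.Iic (Nat.find hex), ∀ w ∈ L.toFinset,
        (c w s = n ↔ (P w).Dom.encard = n) := by
      rw [eventually_all_finite (Set.finite_Iic _)]
      intro n _
      rw [eventually_all_finset]
      exact fun w _ => hcP w n
    filter_upwards [h1, eventually_gt_atTop (Nat.find hex)] with s h2 h3
    rw [List.findIdx_eq (by simpa using h3)]
    simp only [List.getElem_range, decide_eq_true_eq, decide_eq_false_iff_not]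
    constructor
    · intro w hw h
      exact Nat.find_spec hex w hw ((h2 _ Set.self_mem_Iic w (List.mem_toFinset.2 hw)).1 h)
    · intro j hj h
      refine Nat.find_min hex hj fun w hw h' => h w hw ?_
      exact (h2 j hj.le w (List.mem_toFinset.2 hw)).2 h'
  · by_contra! hlt
    exact Nat.find_spec hex q (mem_wordsUpTo.2 hlt) hq

/-! ### Stages from which a sequence is constant -/

/-- `s` is the least index from which the sequence `b` is constant. -/
def Settles {σ : Type} (b : ℕ → σ) (s : ℕ) : Prop :=
  (s = 0 ∨ b (s - 1) ≠ b s) ∧ ∀ u, b (s + u) = b s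

theorem Settles.le {σ : Type} {b : ℕ → σ} {s t : ℕ} (hs : Settles b s) (ht : Settles b t) :
    s ≤ t := by
  by_contra! h
  rcases hs.1 with rfl | h1
  · omega
  · have h2 := ht.2 (s - 1 - t)
    have h3 := ht.2 (s - t)
    rw [show t + (s - 1 - t) = s - 1 by omega] at h2
    rw [show t + (s - t) = s by omega] at h3
    exact h1 (h2.trans h3.symm)

theorem Settles.unique {σ : Type} {b : ℕ → σ} {s t : ℕ} (hs : Settles b s) (ht : Settles b t) :
    s = t :=
  le_antisymm (hs.le ht) (ht.le hs)

theorem Settles.eventually {σ : Type} {b : ℕ → σ} {s : ℕ} (hs : Settles b s) :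
    ∀ᶠ t in atTop, b t = b s := by
  filter_upwards [eventually_ge_atTop s] with t ht
  rw [← hs.2 (t - s), Nat.add_sub_cancel' ht]

theorem exists_settles {σ : Type} {b : ℕ → σ} {y : σ} (hb : ∀ᶠ t in atTop, b t = y) :
    ∃ s, Settles b s ∧ b s = y := by
  classical
  have hex : ∃ s, ∀ u, b (s + u) = b s := by
    obtain ⟨N, hN⟩ := eventually_atTop.1 hb
    exact ⟨N, fun u => (hN _ (by omega)).trans (hN N le_rfl).symm⟩
  have hs : Settles b (Nat.find hex) := by
    refine ⟨?_, Nat.find_spec hex⟩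
    by_contra! h
    refine Nat.find_min hex (Nat.sub_lt (Nat.pos_of_ne_zero h.1) one_pos) fun u => ?_
    rcases u with - | u
    · rfl
    · rw [h.2, ← Nat.find_spec hex u]
      congr 1
      omega
  obtain ⟨t, h1, h2⟩ := (hs.eventually.and hb).exists
  exact ⟨_, hs, h1.symm.trans h2⟩

/-! ### Halting and infinite computations with oracle `∅'` -/

/-- Only one first coordinate occurs, the stage at which `b` settles. The translation uses `d = 0`;
the gap uses `d = 1` to exceed each limit. -/
theorem encard_settles {b : ℕ → ℕ} {n d : ℕ} (hb : ∀ᶠ t in atTop, b t = n) :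
    {m : ℕ | m.unpair.2 < b m.unpair.1 + d ∧ Settles b m.unpair.1}.encard = (n + d : ℕ) := by
  obtain ⟨s, hs, rfl⟩ := exists_settles hb
  have : {m : ℕ | m.unpair.2 < b m.unpair.1 + d ∧ Settles b m.unpair.1} =
      (fun i => Nat.pair s i) '' (Finset.range (b s + d) : Set ℕ) := by
    ext m
    constructor
    · rintro ⟨h1, h2⟩
      have := h2.unique hs
      exact ⟨m.unpair.2, by simpa [this] using h1, by
        dsimp only
        rw [← this, Nat.pair_unpair]⟩
    · rintro ⟨i, hi, rfl⟩
      simpa [hs] using hi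
  rw [this, Function.Injective.encard_image fun i j hij => (Nat.pair_eq_pair.1 hij).2,
    Set.encard_coe_eq_coe_finsetCard, Finset.card_range]

theorem finite_settles (b : ℕ → ℕ) (d : ℕ) :
    {m : ℕ | m.unpair.2 < b m.unpair.1 + d ∧ Settles b m.unpair.1}.Finite := by
  by_cases h : ∃ s, Settles b s
  · obtain ⟨s, hs⟩ := h
    exact Set.finite_of_encard_eq_coe (encard_settles (d := d) hs.eventually)
  · exact Set.finite_empty.subset fun m hm => h ⟨_, hm.2⟩

/-- This is the prenex form required by `infLangJump_of_forall`: one unbounded universal quantifier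
before a primitive recursive matrix. -/
theorem settles_iff_forall {σ : Type} {b : ℕ → σ} {s : ℕ} :
    Settles b s ↔ ∀ u, (s = 0 ∨ b (s - 1) ≠ b s) ∧ b (s + u) = b s :=
  (forall_and_left _ _).symm

theorem primrecRel_settles {α : Type} [Primcodable α] {σ : Type} [Primcodable σ]
    {b : α → ℕ → σ} {s : α → ℕ}
    (hb : Primrec₂ b) (hs : Primrec s) :
    PrimrecRel fun (x : α) (u : ℕ) => (s x = 0 ∨ b x (s x - 1) ≠ b x (s x)) ∧
      b x (s x + u) = b x (s x) := by
  classical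
  have h1 := hs.comp (Primrec.fst (α := α) (β := ℕ))
  have h2 := hb.comp Primrec.fst h1
  exact ((Primrec.eq.comp h1 (Primrec.const 0)).or (Primrec.eq.comp
    (hb.comp Primrec.fst (Primrec.pred.comp h1)) h2).not).and
    (Primrec.eq.comp (hb.comp Primrec.fst (Primrec.nat_add.comp h1 Primrec.snd)) h2)

/-- The settling stage of an approximation is recognised by a co-enumerable condition. So the oracle
decides whether time `Nat.pair s i` carries a symbol: `s` must be that stage and `i` less than the
value there. -/
theorem reduces_haltLangJump_infLangJump :
    Reduces HaltLangJump haltOut InfLangJump unaryOut := by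
  classical
  intro V hV
  obtain ⟨a, ha, haV⟩ := exists_approximates_haltLangJump hV
  have hs := Primrec.fst.comp (Primrec.unpair.comp (Primrec.snd (α := List Bool) (β := ℕ)))
  have hi := Primrec.snd.comp (Primrec.unpair.comp (Primrec.snd (α := List Bool) (β := ℕ)))
  have hS := primrecRel_settles (b := fun x : List Bool × ℕ => a x.1)
    (ha.comp (Primrec.fst.comp Primrec.fst) Primrec.snd) hs
  have hR := (PrimrecPred.and (Primrec.nat_lt.comp (hi.comp Primrec.fst)
    ((ha.comp Primrec.fst hs).comp (Primrec.fst (β := ℕ)))) hS).primrecRel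
  refine ⟨_, infLangJump_of_forall hR, .of_forall fun p n hn => ?_⟩
  have := encard_settles (d := 0) (haV p n hn)
  simpa [unaryOut, forall_and_left, settles_iff_forall] using this

/-- The union over short programs used for `K` and `cardN`, with settling stages in place of
halting: each limit `v` contributes `v + 1` elements, and the union stays co-enumerable. -/
theorem exists_infLangJump_haltLangJump_gap {U : List Bool → Part ℕ} (hU : HaltLangJump U) :
    ∃ W, InfLangJump W ∧ ∀ p, ∃ n, unaryOut (W p) n ∧
      ∀ q, haltOut (U q) n → 2 * p.length < q.length := by
  classical
  obtain ⟨a, ha, haU⟩ := exists_approximates_haltLangJump hU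
  have hm := Primrec.unpair.comp (Primrec.snd (α := List Bool) (β := ℕ))
  have hw := primrec_wordAt.comp (Primrec.fst.comp hm)
  have hs := Primrec.fst.comp (Primrec.unpair.comp (Primrec.snd.comp hm))
  have hi := Primrec.snd.comp (Primrec.unpair.comp (Primrec.snd.comp hm))
  have hS := primrecRel_settles (b := fun x : List Bool × ℕ => a (wordAt x.2.unpair.1))
    (ha.comp (hw.comp Primrec.fst) Primrec.snd) hs
  have hshort := primrecRel_shortPair.comp (Primrec.nat_mul.comp (Primrec.const 2)
    (Primrec.list_length.comp (Primrec.fst (α := List Bool) (β := ℕ)))) Primrec.snd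
  have hR := (PrimrecPred.and (hshort.comp (Primrec.fst (β := ℕ)))
    (PrimrecPred.and (Primrec.nat_lt.comp (hi.comp Primrec.fst)
      (Primrec.succ.comp ((ha.comp hw hs).comp (Primrec.fst (β := ℕ))))) hS)).primrecRel
  refine ⟨_, infLangJump_of_forall hR, fun p => ?_⟩
  obtain ⟨n, hn, hle⟩ := exists_encard_eq (fun q => finite_settles (a q) 1) (2 * p.length)
  refine ⟨n, ?_, fun q hq => ?_⟩
  · simpa [unaryOut, forall_and_left, settles_iff_forall] using hn
  · by_contra! hlt
    have h := hle q hlt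
    rw [encard_settles (haU q n hq), Nat.cast_le] at h
    omega

/-! ### Stages of the enumeration of a generated preorder -/

section

variable {E : ℕ → ℕ → ℕ → Prop}

open Classical in
/-- The end of the walk from `x` along the list `l`, if all its steps are in the relation `E` at
stage `s`. -/
def walkEnd (E : ℕ → ℕ → ℕ → Prop) (s x : ℕ) (l : List ℕ) : Option ℕ :=
  l.foldl (fun o y => o.bind fun z => if E z y s then some y else none) (some x)

theorem walkEnd_append_singleton {s x y : ℕ} {l : List ℕ} :
    walkEnd E s x (l ++ [y]) = some y ↔ ∃ z, walkEnd E s x l = some z ∧ E z y s := by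
  simp [walkEnd, Option.bind_eq_some_iff]

theorem eq_of_walkEnd_append_singleton {s x y y' : ℕ} {l : List ℕ}
    (h : walkEnd E s x (l ++ [y]) = some y') : y = y' := by
  simp only [walkEnd, List.foldl_append, List.foldl_cons, List.foldl_nil,
    Option.bind_eq_some_iff, Option.ite_none_right_eq_some, Option.some.injEq] at h
  exact h.choose_spec.2.2

/-- A walk from `x` to `y` is found at stage `s`. -/
def ReachAt (E : ℕ → ℕ → ℕ → Prop) (x y s : ℕ) : Prop :=
  ∃ m < s, walkEnd E s x ((decode (α := List ℕ) m).getD []) = some y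

variable (hE : ∀ z y s t, s ≤ t → E z y s → E z y t)
include hE

theorem walkEnd_mono {s t x y : ℕ} {l : List ℕ} (hst : s ≤ t) (h : walkEnd E s x l = some y) :
    walkEnd E t x l = some y := by
  induction l using List.reverseRecOn generalizing y with
  | nil => exact h
  | append_singleton l a ih =>
    obtain rfl := eq_of_walkEnd_append_singleton h
    obtain ⟨z, hz, hzy⟩ := walkEnd_append_singleton.1 h
    exact walkEnd_append_singleton.2 ⟨z, ih hz, hE _ _ _ _ hst hzy⟩

theorem exists_walkEnd_iff {x y : ℕ} : (∃ l s, walkEnd E s x l = some y) ↔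
    Relation.ReflTransGen (fun a b => ∃ s, E a b s) x y := by
  constructor
  · rintro ⟨l, s, h⟩
    induction l using List.reverseRecOn generalizing y with
    | nil =>
      obtain rfl : x = y := by simpa [walkEnd] using h
      exact .refl
    | append_singleton l a ih =>
      obtain rfl := eq_of_walkEnd_append_singleton h
      obtain ⟨z, hz, hzy⟩ := walkEnd_append_singleton.1 h
      exact (ih hz).tail ⟨s, hzy⟩
  · intro h
    induction h with
    | refl => exact ⟨[], 0, rfl⟩
    | @tail z y _ hzy ih =>
      obtain ⟨l, s, hl⟩ := ih
      obtain ⟨t, ht⟩ := hzy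
      exact ⟨l ++ [y], max s t, walkEnd_append_singleton.2
        ⟨z, walkEnd_mono hE (le_max_left s t) hl, hE _ _ _ _ (le_max_right s t) ht⟩⟩

/-- A walk uses finitely many edges, all enumerated by some stage, and its code is eventually below
`s`. -/
theorem eventually_reachAt_iff (x y : ℕ) : ∀ᶠ s in atTop,
    (ReachAt E x y s ↔ Relation.ReflTransGen (fun a b => ∃ s, E a b s) x y) := by
  by_cases h : Relation.ReflTransGen (fun a b => ∃ s, E a b s) x y
  · obtain ⟨l, s, hl⟩ := (exists_walkEnd_iff hE).2 h
    filter_upwards [eventually_ge_atTop s, eventually_gt_atTop (encode l)] with t h1 h2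
    exact iff_of_true ⟨encode l, h2, by simpa using walkEnd_mono hE h1 hl⟩ h
  · refine Eventually.of_forall fun s => iff_of_false ?_ h
    rintro ⟨m, -, hm⟩
    exact h ((exists_walkEnd_iff hE).1 ⟨_, s, hm⟩)

end

theorem primrec_walkEnd {α : Type} [Primcodable α] {E : α → ℕ → ℕ → ℕ → Prop}
    (hE : PrimrecRel fun (a : α × ℕ × ℕ) (s : ℕ) => E a.1 a.2.1 a.2.2 s) :
    Primrec fun a : α × ℕ × ℕ × List ℕ => walkEnd (E a.1) a.2.1 a.2.2.1 a.2.2.2 := by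
  classical
  refine Primrec.list_foldl (Primrec.snd.comp (Primrec.snd.comp Primrec.snd))
    (Primrec.option_some.comp (Primrec.fst.comp (Primrec.snd.comp Primrec.snd)))
    (h := fun (a : α × ℕ × ℕ × List ℕ) (q : Option ℕ × ℕ) =>
      q.1.bind fun z => if E a.1 z q.2 a.2.1 then some q.2 else none) ?_
  refine Primrec.option_bind (Primrec.fst.comp Primrec.snd) (Primrec.ite ?_ ?_ (Primrec.const _))
  · have ha := Primrec.fst.comp
      (Primrec.fst (α := (α × ℕ × ℕ × List ℕ) × Option ℕ × ℕ) (β := ℕ))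
    exact hE.comp ((Primrec.fst.comp ha).pair (Primrec.snd.pair
      (Primrec.snd.comp (Primrec.snd.comp Primrec.fst)))) (Primrec.fst.comp (Primrec.snd.comp ha))
  · exact Primrec.option_some.comp (Primrec.snd.comp (Primrec.snd.comp Primrec.fst))

theorem primrecRel_reachAt {α : Type} [Primcodable α] {E : α → ℕ → ℕ → ℕ → Prop}
    (hE : PrimrecRel fun (a : α × ℕ × ℕ) (s : ℕ) => E a.1 a.2.1 a.2.2 s) :
    PrimrecRel fun (a : α × ℕ × ℕ) (s : ℕ) => ReachAt (E a.1) a.2.1 a.2.2 s := by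
  refine primrecPred_exists_lt (R := fun m (q : (α × ℕ × ℕ) × ℕ) =>
    walkEnd (E q.1.1) q.2 q.1.2.1 ((decode (α := List ℕ) m).getD []) = some q.1.2.2) ?_ Primrec.snd
  have hq := Primrec.snd (α := ℕ) (β := (α × ℕ × ℕ) × ℕ)
  have hl := Primrec.option_getD.comp
    (Primrec.decode.comp (Primrec.fst (α := ℕ) (β := (α × ℕ × ℕ) × ℕ)))
    (Primrec.const ([] : List ℕ))
  have h1 := Primrec.fst.comp hq
  exact Primrec.eq.comp ((primrec_walkEnd hE).comp ((Primrec.fst.comp h1).pair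
    ((Primrec.snd.comp hq).pair ((Primrec.fst.comp (Primrec.snd.comp h1)).pair hl))))
    (Primrec.option_some.comp (Primrec.snd.comp (Primrec.snd.comp h1)))

/-! ### Ordinals from cardinals -/

/-- `x` is the least element of its class, in the preorder generated by the domain of `f`. -/
def LeastInClass (f : ℕ × ℕ →. ℕ) (x : ℕ) : Prop :=
  (∃ y, (x, y) ∈ f.Dom ∨ (y, x) ∈ f.Dom) ∧ ∀ y < x,
    ¬(Relation.ReflTransGen (fun a b => (a, b) ∈ f.Dom) x y ∧
      Relation.ReflTransGen (fun a b => (a, b) ∈ f.Dom) y x)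

/-- The least elements form a transversal of the classes. -/
theorem encard_leastInClass {f : ℕ × ℕ →. ℕ} {n : ℕ} (h : ordN f n) :
    {x | LeastInClass f x}.encard = n := by
  classical
  obtain ⟨e⟩ := h
  let φ : {x | LeastInClass f x} → Antisymmetrization (RelField f) (· ≤ ·) :=
    fun x => toAntisymmetrization (· ≤ ·) ⟨x.1, x.2.1⟩
  have hle : ∀ x y : RelField f, toAntisymmetrization (· ≤ ·) x = toAntisymmetrization (· ≤ ·) y →
      x ≤ y ∧ y ≤ x := fun x y hxy =>
    ⟨toAntisymmetrization_le_toAntisymmetrization_iff.1 hxy.le,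
      toAntisymmetrization_le_toAntisymmetrization_iff.1 hxy.ge⟩
  have hφ : Function.Bijective φ := by
    constructor
    · rintro ⟨x, hx⟩ ⟨y, hy⟩ hxy
      obtain ⟨h1, h2⟩ := hle _ _ hxy
      rcases lt_trichotomy x y with hlt | heq | hlt
      · exact absurd ⟨h2, h1⟩ (hy.2 x hlt)
      · exact Subtype.ext heq
      · exact absurd ⟨h1, h2⟩ (hx.2 y hlt)
    · intro q
      induction q using Antisymmetrization.ind with
      | _ z =>
      have hex : ∃ x, ∃ w : RelField f, w.1 = x ∧ w ≤ z ∧ z ≤ w := ⟨z.1, z, rfl, le_rfl, le_rfl⟩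
      obtain ⟨w, hw, h1, h2⟩ := Nat.find_spec hex
      refine ⟨⟨w.1, w.2, fun y hy hwy => Nat.find_min hex (hw ▸ hy) ?_⟩, ?_⟩
      -- A number equivalent to `w` but different from it starts a nonempty path, hence lies in the
      -- field.
      · have hy' : ∃ u, (y, u) ∈ f.Dom ∨ (u, y) ∈ f.Dom := by
          rcases Relation.ReflTransGen.cases_head hwy.2 with heq | ⟨u, hu, -⟩
          · exact absurd heq hy.ne
          · exact ⟨u, Or.inl hu⟩
        exact ⟨⟨y, hy'⟩, rfl, Relation.ReflTransGen.trans hwy.2 h1,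
          Relation.ReflTransGen.trans h2 hwy.1⟩
      · exact le_antisymm (toAntisymmetrization_le_toAntisymmetrization_iff.2 h1)
          (toAntisymmetrization_le_toAntisymmetrization_iff.2 h2)
  rw [Set.encard, ENat.card_congr ((Equiv.ofBijective φ hφ).trans e.toEquiv)]
  simp

/-- Being least in one's class is a Boolean combination, with a bounded quantifier, of enumerable
conditions, so its truth value at stage `s` converges. -/
theorem reduces_funLang_infLangJump :
    Reduces (FunLang (X := ℕ × ℕ)) ordN InfLangJump unaryOut := by
  classical
  intro V hV
  obtain ⟨D, hD, hmono, hdom⟩ := exists_stages hV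
  have hE : PrimrecRel fun (a : List Bool × ℕ × ℕ) (s : ℕ) => D (a.1, a.2.1, a.2.2) s := hD
  have hreach := primrecRel_reachAt (E := fun p z y s => D (p, z, y) s) hE
  have hfield : PrimrecRel fun (a : List Bool × ℕ) (s : ℕ) =>
      ∃ y < s, D (a.1, a.2, y) s ∨ D (a.1, y, a.2) s := by
    refine primrecPred_exists_lt (R := fun y (q : (List Bool × ℕ) × ℕ) =>
      D (q.1.1, q.1.2, y) q.2 ∨ D (q.1.1, y, q.1.2) q.2) ?_ Primrec.snd
    have hq := Primrec.snd (α := ℕ) (β := (List Bool × ℕ) × ℕ)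
    have hp := Primrec.fst.comp (Primrec.fst.comp hq)
    have hx := Primrec.snd.comp (Primrec.fst.comp hq)
    exact (hD.comp (hp.pair (hx.pair Primrec.fst)) (Primrec.snd.comp hq)).or
      (hD.comp (hp.pair (Primrec.fst.pair hx)) (Primrec.snd.comp hq))
  have hleast : PrimrecRel fun (a : List Bool × ℕ) (s : ℕ) => ∀ y < a.2,
      ¬(ReachAt (fun z y s => D (a.1, z, y) s) a.2 y s ∧
        ReachAt (fun z y s => D (a.1, z, y) s) y a.2 s) := by
    refine primrecPred_forall_lt (R := fun y (q : (List Bool × ℕ) × ℕ) =>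
      ¬(ReachAt (fun z y s => D (q.1.1, z, y) s) q.1.2 y q.2 ∧
        ReachAt (fun z y s => D (q.1.1, z, y) s) y q.1.2 q.2)) ?_ (Primrec.snd.comp Primrec.fst)
    have hq := Primrec.snd (α := ℕ) (β := (List Bool × ℕ) × ℕ)
    have hp := Primrec.fst.comp (Primrec.fst.comp hq)
    have hx := Primrec.snd.comp (Primrec.fst.comp hq)
    exact ((hreach.comp (hp.pair (hx.pair Primrec.fst)) (Primrec.snd.comp hq)).and
      (hreach.comp (hp.pair (Primrec.fst.pair hx)) (Primrec.snd.comp hq))).not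
  have hA := PrimrecPred.and hfield hleast
  refine ⟨fun p x => decide (LeastInClass (V p) x), infLangJump_of_limit
    (Primrec₂.to_comp (PrimrecRel.decide (R := fun (a : List Bool × ℕ) (s : ℕ) =>
      (∃ y < s, D (a.1, a.2, y) s ∨ D (a.1, y, a.2) s) ∧ ∀ y < a.2,
      ¬(ReachAt (fun z y s => D (a.1, z, y) s) a.2 y s ∧
        ReachAt (fun z y s => D (a.1, z, y) s) y a.2 s)) hA)) fun p x => ?_,
    .of_forall fun p n hn => ?_⟩
  · have hDp : ∀ z y s t, s ≤ t → D (p, z, y) s → D (p, z, y) t := fun z y => hmono _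
    have hrel : (fun a b => ∃ s, D (p, a, b) s) = fun a b => (a, b) ∈ (V p).Dom := by
      funext a b
      exact propext (hdom p (a, b)).symm
    have h1 : ∀ᶠ s in atTop, ((∃ y < s, D (p, x, y) s ∨ D (p, y, x) s) ↔
        ∃ y, (x, y) ∈ (V p).Dom ∨ (y, x) ∈ (V p).Dom) := by
      by_cases h : ∃ y, (x, y) ∈ (V p).Dom ∨ (y, x) ∈ (V p).Dom
      · obtain ⟨y, hy⟩ := id h
        rw [hdom, hdom, ← exists_or] at hy
        obtain ⟨s, hs⟩ := hy
        filter_upwards [eventually_ge_atTop s, eventually_gt_atTop y] with t ht hyt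
        exact iff_of_true ⟨y, hyt, hs.imp (hDp _ _ _ _ ht) (hDp _ _ _ _ ht)⟩ h
      · refine Eventually.of_forall fun s => iff_of_false ?_ h
        rintro ⟨y, -, hy⟩
        exact h ⟨y, hy.imp (fun h => (hdom _ _).2 ⟨s, h⟩) (fun h => (hdom _ _).2 ⟨s, h⟩)⟩
    have h2 : ∀ᶠ s in atTop, ∀ y ∈ Set.Iio x,
        ((ReachAt (fun z y s => D (p, z, y) s) x y s ↔
          Relation.ReflTransGen (fun a b => (a, b) ∈ (V p).Dom) x y) ∧
        (ReachAt (fun z y s => D (p, z, y) s) y x s ↔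
          Relation.ReflTransGen (fun a b => (a, b) ∈ (V p).Dom) y x)) := by
      rw [eventually_all_finite (Set.finite_Iio _)]
      intro y _
      rw [← hrel]
      exact (eventually_reachAt_iff hDp x y).and (eventually_reachAt_iff hDp y x)
    filter_upwards [h1, h2] with s h3 h4
    rw [decide_eq_decide]
    refine and_congr h3 (forall₂_congr fun y hy => ?_)
    rw [(h4 y hy).1, (h4 y hy).2]
  · simpa [unaryOut] using encard_leastInClass hn

-- The counting function of `S` grows from `0` to `n` in steps of at most one, so it takes every
-- value between.
open Classical in
theorem exists_count_eq {S : Set ℕ} {n : ℕ} (hS : S.encard = n) :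
    (∀ x, Nat.count (· ∈ S) x ≤ n) ∧ ∀ k ≤ n, ∃ x, Nat.count (· ∈ S) x = k := by
  have hfin := Set.finite_of_encard_eq_coe hS
  have hcard : hfin.toFinset.card = n := by
    rw [hfin.encard_eq_coe_toFinset_card] at hS
    exact_mod_cast hS
  refine ⟨fun x => ?_, fun k hk => ?_⟩
  · rw [Nat.count_eq_card_filter_range, ← hcard]
    exact Finset.card_le_card fun y hy => by simpa using (Finset.mem_filter.1 hy).2
  · have hex : ∃ x, k ≤ Nat.count (· ∈ S) x := by
      refine ⟨hfin.toFinset.sup id + 1, hk.trans ?_⟩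
      rw [Nat.count_eq_card_filter_range, ← hcard]
      refine Finset.card_le_card fun y hy => Finset.mem_filter.2 ⟨?_, by simpa using hy⟩
      exact Finset.mem_range_succ_iff.2 (Finset.le_sup (f := id) hy)
    refine ⟨Nat.find hex, le_antisymm ?_ (Nat.find_spec hex)⟩
    rcases hx : Nat.find hex with - | x
    · simp
    · have h1 := not_le.1 (Nat.find_min hex (m := x) (by omega))
      rw [Nat.count_succ]
      split_ifs <;> omega

/-- If `x` and `x + 1` are equivalent exactly for `x ∉ S`, the quotient order has one element more
than `S`. -/
theorem ordN_of_dom {f : ℕ × ℕ →. ℕ} {S : Set ℕ} {n : ℕ} (hS : S.encard = n)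
    (hf : ∀ x y, (x, y) ∈ f.Dom ↔ x ≤ y ∨ (x = y + 1 ∧ y ∉ S)) : ordN f (n + 1) := by
  classical
  obtain ⟨hle, hsurj⟩ := exists_count_eq hS
  -- The position of `x` in the quotient is the number of elements of `S` below `x`.
  have hrel : ∀ x y, Relation.ReflTransGen (fun a b => (a, b) ∈ f.Dom) x y ↔
      Nat.count (· ∈ S) x ≤ Nat.count (· ∈ S) y := by
    intro x y
    constructor
    · intro h
      induction h with
      | refl => exact le_rfl
      | @tail z y _ hzy ih =>
        refine ih.trans ?_
        rcases (hf z y).1 hzy with h | ⟨rfl, h⟩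
        · exact Nat.count_monotone _ h
        · simp [Nat.count_succ, h]
    · intro h
      rcases le_total x y with hxy | hxy
      · exact .single ((hf x y).2 (Or.inl hxy))
      -- From `x` one descends to `y` by unit steps; equal counts mean that no element of `S` blocks
      -- the way.
      · induction x, hxy using Nat.le_induction with
        | base => exact .refl
        | succ x hyx ih =>
          have h1 := Nat.count_monotone (· ∈ S) hyx
          rw [Nat.count_succ] at h
          split_ifs at h with hx
          · omega
          · exact .head ((hf _ _).2 (Or.inr ⟨rfl, hx⟩)) (ih h)
  let g : RelField f → Fin (n + 1) := fun x => ⟨Nat.count (· ∈ S) x.1, Nat.lt_succ_of_le (hle _)⟩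
  have hg : ∀ x y, g x ≤ g y ↔ x ≤ y := fun x y => (hrel x.1 y.1).symm
  refine ⟨RelIso.ofSurjective (OrderEmbedding.ofMapLEIff
    (fun q => g (ofAntisymmetrization (· ≤ ·) q)) fun p q =>
      (hg _ _).trans ofAntisymmetrization_le_ofAntisymmetrization_iff) fun k => ?_⟩
  obtain ⟨x, hx⟩ := hsurj k.1 (Nat.le_of_lt_succ k.2)
  let z : RelField f := ⟨x, x, Or.inl ((hf x x).2 (Or.inl le_rfl))⟩
  refine ⟨toAntisymmetrization (· ≤ ·) z, ?_⟩
  have hz : g z = k := Fin.ext hx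
  have h1 : AntisymmRel (· ≤ ·) (ofAntisymmetrization (· ≤ ·) (toAntisymmetrization (· ≤ ·) z)) z :=
    Quotient.exact (toAntisymmetrization_ofAntisymmetrization (· ≤ ·) (toAntisymmetrization _ z))
  rw [← hz]
  exact le_antisymm ((hg _ _).2 h1.1) ((hg _ _).2 h1.2)

/-- Each `t` settles at exactly one stage, so pairing it with that stage keeps the cardinal. The
gain is in complexity: from decidable in `∅'` to co-enumerable. -/
theorem encard_settles_true {b : ℕ → ℕ → Bool} {v : ℕ → Bool}
    (hb : ∀ t, ∀ᶠ s in atTop, b t s = v t) :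
    {m : ℕ | Settles (b m.unpair.1) m.unpair.2 ∧ b m.unpair.1 m.unpair.2 = true}.encard =
      {t | v t = true}.encard := by
  have hv : ∀ {t s}, Settles (b t) s → b t s = v t := fun {t s} hs => by
    obtain ⟨u, h1, h2⟩ := (hs.eventually.and (hb t)).exists
    exact h1.symm.trans h2
  rw [← Set.InjOn.encard_image (f := fun m : ℕ => m.unpair.1)
    (s := {m : ℕ | Settles (b m.unpair.1) m.unpair.2 ∧ b m.unpair.1 m.unpair.2 = true})]
  · congr 1
    ext t
    constructor
    · rintro ⟨m, ⟨h1, h2⟩, rfl⟩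
      exact (hv h1).symm.trans h2
    · intro ht
      obtain ⟨s, hs, hst⟩ := exists_settles (hb t)
      exact ⟨Nat.pair t s, by simpa using ⟨hs, hst.trans ht⟩, by simp⟩
  · rintro m ⟨h1, -⟩ m' ⟨h2, -⟩ (h : m.unpair.1 = m'.unpair.1)
    rw [← Nat.pair_unpair m, ← Nat.pair_unpair m', h]
    rw [h] at h1
    rw [h1.unique h2]

/-- This compensates for the extra class in `ordN_of_dom`. -/
theorem encard_drop_first {S : Set ℕ} {n : ℕ} (hS : S.encard = (n + 1 : ℕ)) :
    {t | t ∈ S ∧ ∃ u < t, u ∈ S}.encard = n := by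
  classical
  have hne : ∃ t, t ∈ S := by
    rw [← Set.Nonempty, ← Set.encard_ne_zero, hS]
    exact_mod_cast Nat.succ_ne_zero n
  have : {t | t ∈ S ∧ ∃ u < t, u ∈ S} = S \ {Nat.find hne} := by
    ext t
    simp only [Set.mem_ofPred_eq, Set.mem_sdiff, Set.mem_singleton_iff]
    refine and_congr_right fun ht => ⟨?_, fun h => ?_⟩
    · rintro ⟨u, hu, huS⟩ rfl
      exact Nat.find_min hne hu huS
    · exact ⟨Nat.find hne, lt_of_le_of_ne (Nat.find_min' hne ht) (Ne.symm h), Nat.find_spec hne⟩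
  rw [this]
  have h := Set.encard_sdiff_singleton_add_one (Nat.find_spec hne)
  rw [hS] at h
  push_cast at h
  exact ENat.add_left_injective_of_ne_top ENat.one_ne_top h

theorem ordN_zero_of_dom {f : ℕ × ℕ →. ℕ} (hf : ∀ x y, (x, y) ∉ f.Dom) : ordN f 0 := by
  have : IsEmpty (RelField f) := ⟨fun ⟨x, y, h⟩ => h.elim (hf x y) (hf y x)⟩
  have : IsEmpty (Antisymmetrization (RelField f) (· ≤ ·)) :=
    ⟨fun q => this.elim (ofAntisymmetrization (· ≤ ·) q)⟩
  exact ⟨OrderIso.ofIsEmpty _ _⟩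

/-- The output times other than the first are replaced by a co-enumerable set `B p` of the same
cardinal. Its complement is enumerable, hence so is the relation that makes `y` and `y + 1`
equivalent for `y ∉ B p`. -/
theorem reduces_infLangJump_funLang :
    Reduces InfLangJump unaryOut (FunLang (X := ℕ × ℕ)) ordN := by
  classical
  intro V hV
  obtain ⟨a, ha, haV⟩ := exists_approximates_infLangJump hV
  obtain ⟨b, hb, hbV⟩ : ∃ b : List Bool × ℕ → ℕ → Bool, Primrec₂ b ∧ ∀ p t, ∀ᶠ s in atTop,
      b (p, t) s = decide (V p t = true ∧ ∃ u < t, V p u = true) := by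
    have hR : PrimrecRel fun (x : List Bool × ℕ) (s : ℕ) =>
        a x.1 x.2 s = true ∧ ∃ u < x.2, a x.1 u s = true := by
      refine PrimrecPred.and (Primrec.eq.comp ha (Primrec.const true)) (primrecPred_exists_lt
        (R := fun u (q : (List Bool × ℕ) × ℕ) => a q.1.1 u q.2 = true) ?_
        (Primrec.snd.comp Primrec.fst))
      exact Primrec.eq.comp (ha.comp (((Primrec.fst.comp (Primrec.fst.comp Primrec.snd)).pair
        Primrec.fst).pair (Primrec.snd.comp Primrec.snd))) (Primrec.const true)
    refine ⟨_, hR.decide, fun p t => ?_⟩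
    have h : ∀ᶠ s in atTop, ∀ u ∈ Set.Iio t, a p u s = V p u := by
      rw [eventually_all_finite (Set.finite_Iio _)]
      exact fun u _ => haV p u
    filter_upwards [h, haV p t] with s h1 h2
    rw [decide_eq_decide, h2]
    exact and_congr_right fun _ => exists_congr fun u => and_congr_right fun hu => by
      rw [h1 u hu]
  let B : List Bool → Set ℕ := fun p =>
    {m | Settles (b (p, m.unpair.1)) m.unpair.2 ∧ b (p, m.unpair.1) m.unpair.2 = true}
  obtain ⟨Q, hQ, hBQ⟩ : ∃ Q : List Bool × ℕ → ℕ → Prop, PrimrecRel Q ∧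
      ∀ p m, m ∈ B p ↔ ∀ u, Q (p, m) u := by
    refine ⟨fun x u => ((x.2.unpair.2 = 0 ∨
        b (x.1, x.2.unpair.1) (x.2.unpair.2 - 1) ≠ b (x.1, x.2.unpair.1) x.2.unpair.2) ∧
        b (x.1, x.2.unpair.1) (x.2.unpair.2 + u) = b (x.1, x.2.unpair.1) x.2.unpair.2) ∧
      b (x.1, x.2.unpair.1) x.2.unpair.2 = true, ?_, fun p m => ?_⟩
    · have hm := Primrec.unpair.comp (Primrec.snd (α := List Bool) (β := ℕ))
      have hx := (Primrec.fst (α := List Bool) (β := ℕ)).pair (Primrec.fst.comp hm)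
      exact PrimrecPred.and (primrecRel_settles
        (b := fun x : List Bool × ℕ => b (x.1, x.2.unpair.1))
        (hb.comp (hx.comp Primrec.fst) Primrec.snd) (Primrec.snd.comp hm))
        (Primrec.eq.comp ((hb.comp hx (Primrec.snd.comp hm)).comp Primrec.fst)
          (Primrec.const true))
    · rw [forall_and_right, ← settles_iff_forall]
      rfl
  -- Order type `0` is out of reach of `ordN_of_dom`, so the empty word is reserved for the empty
  -- relation and all other programs are shifted by one symbol; this is the constant `1` below.
  have hT : PrimrecRel fun (x : List Bool × (ℕ × ℕ)) (u : ℕ) =>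
      x.1 ≠ [] ∧ (x.2.1 ≤ x.2.2 ∨ (x.2.1 = x.2.2 + 1 ∧ ¬Q (x.1.tail, x.2.2) u)) := by
    have hp := Primrec.fst.comp (Primrec.fst (α := List Bool × (ℕ × ℕ)) (β := ℕ))
    have hy := Primrec.snd.comp (Primrec.fst (α := List Bool × (ℕ × ℕ)) (β := ℕ))
    exact (Primrec.eq.comp hp (Primrec.const [])).not.and
      ((Primrec.nat_le.comp (Primrec.fst.comp hy) (Primrec.snd.comp hy)).or
        ((Primrec.eq.comp (Primrec.fst.comp hy) (Primrec.succ.comp (Primrec.snd.comp hy))).and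
          (hQ.comp ((Primrec.list_tail.comp hp).pair (Primrec.snd.comp hy)) Primrec.snd).not))
  obtain ⟨W, hW, hdom⟩ : ∃ W : List Bool → ℕ × ℕ →. ℕ, FunLang W ∧ ∀ p x y,
      (x, y) ∈ (W p).Dom ↔ ∃ u, p ≠ [] ∧ (x ≤ y ∨ (x = y + 1 ∧ ¬Q (p.tail, y) u)) := by
    refine ⟨_, (Partrec.rfind hT.decide.to_comp.partrec₂).to₂, fun p x y => ?_⟩
    exact (Nat.rfind_dom').trans (by simp)
  refine ⟨W, hW, .of_exists 1 fun p n hn => ?_⟩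
  rcases n with - | n
  · exact ⟨[], ordN_zero_of_dom fun x y h => by simpa using (hdom [] x y).1 h, by simp⟩
  · refine ⟨true :: p, ordN_of_dom (S := B p) ?_ fun x y => ?_, by simp⟩
    · rw [encard_settles_true (b := fun t => b (p, t)) (hbV p)]
      simpa using! encard_drop_first hn
    · rw [hdom, hBQ]
      simp [exists_or]

end KRep

end

theorem mainTheorem1 :
    -- existence of the optimal and strongly universal languages that define the complexities
    ((∃ U, Optimal HaltLang haltOut U) ∧ (∃ U, Optimal InfLang unaryOut U) ∧
      (∃ U, Optimal HaltLangJump haltOut U) ∧ (∃ U, Optimal InfLangJump unaryOut U) ∧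
      (∃ U, StronglyUniversal EffLang U) ∧ (∃ U, StronglyUniversal CodeLang U) ∧
      (∃ U, StronglyUniversal (FunLang (X := ℕ)) U) ∧ (∃ U, StronglyUniversal PairLang U) ∧
      (∃ U, StronglyUniversal (FunLang (X := ℕ × ℕ)) U)) ∧
    -- comparison of the complexities, for any choice of these languages
    ∀ (U U' : List Bool → Part ℕ) (I I' : List Bool → ℕ → Bool)
      (E : List Bool → PR → PR) (G : List Bool → Nat.Partrec.Code → PR)
      (P : List Bool → ℕ →. ℕ) (Q : List Bool → (ℕ →. ℕ) × (ℕ →. ℕ))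
      (R : List Bool → ℕ × ℕ →. ℕ),
      Optimal HaltLang haltOut U → Optimal InfLang unaryOut I →
      Optimal HaltLangJump haltOut U' → Optimal InfLangJump unaryOut I' →
      StronglyUniversal EffLang E → StronglyUniversal CodeLang G →
      StronglyUniversal FunLang P → StronglyUniversal PairLang Q →
      StronglyUniversal FunLang R →
      -- all the complexities are finite, since `Khalt U` is
      (∀ n, Khalt U n ≠ ⊤) ∧
      (EqCt (KChurchN E) (Khalt U) ∧ EqCt (KChurchZ E) (Khalt U) ∧
        EqCt (KChurchZCode G) (Khalt U)) ∧
      EqCt (KcardN P) (Kinf I) ∧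
      EqCt (KcardZ Q) (Khalt U') ∧
      EqCt (Kord R) (Kinf I') ∧
      -- the strict hierarchy
      (EqCt (KChurchN E) (KChurchZ E) ∧ EqCt (KChurchN E) (KChurchZCode G) ∧
        LtCt (KcardN P) (KChurchN E) ∧ LtCt (KcardN P) (KChurchZ E) ∧
        LtCt (KcardN P) (KChurchZCode G) ∧
        LtCt (KcardZ Q) (KcardN P) ∧ LtCt (Kord R) (KcardZ Q)) := by
  obtain ⟨E₀, hE₀⟩ := exists_stronglyUniversal_effLang
  obtain ⟨G₀, hG₀⟩ := exists_stronglyUniversal_codeLang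
  obtain ⟨P₀, hP₀⟩ := exists_stronglyUniversal_funLang ℕ
  obtain ⟨Q₀, hQ₀⟩ := exists_stronglyUniversal_pairLang
  obtain ⟨R₀, hR₀⟩ := exists_stronglyUniversal_funLang (ℕ × ℕ)
  refine ⟨⟨reduces_effLang_haltLang.exists_optimal reduces_haltLang_effLang (hE₀.optimal _),
    reduces_funLang_infLang.exists_optimal reduces_infLang_funLang (hP₀.optimal _),
    reduces_pairLang_haltLangJump.exists_optimal reduces_haltLangJump_pairLang (hQ₀.optimal _),
    reduces_funLang_infLangJump.exists_optimal reduces_infLangJump_funLang (hR₀.optimal _),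
    ⟨E₀, hE₀⟩, ⟨G₀, hG₀⟩, ⟨P₀, hP₀⟩, ⟨Q₀, hQ₀⟩, ⟨R₀, hR₀⟩⟩, ?_⟩
  intro U U' I I' E G P Q R hU hI hU' hI' hE hG hP hQ hR
  have hP' := hP.optimal cardN
  have hEU : EqCt (KChurchN E) (Khalt U) :=
    reduces_effLang_haltLang.eqCt reduces_haltLang_effLang (hE.optimal churchN) hU
  have hGU : EqCt (KChurchZCode G) (Khalt U) :=
    reduces_codeLang_haltLang.eqCt reduces_haltLang_codeLang (hG.optimal _) hU
  have hQU : EqCt (KcardZ Q) (Khalt U') :=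
    reduces_pairLang_haltLangJump.eqCt reduces_haltLangJump_pairLang (hQ.optimal _) hU'
  have hRI : EqCt (Kord R) (Kinf I') :=
    reduces_funLang_infLangJump.eqCt reduces_infLangJump_funLang (hR.optimal ordN) hI'
  have hlt₁ : LtCt (KcardN P) (Khalt U) := by
    obtain ⟨W, hW, hgap⟩ := exists_funLang_haltLang_gap hU.1
    exact ⟨reduces_haltLang_funLang.leCt hU.1 hP', hP'.exists_add_lt hW hgap⟩
  have hlt₂ : LtCt (Khalt U') (KcardN P) := by
    obtain ⟨W, hW, hgap⟩ := exists_haltLangJump_funLang_gap hP.1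
    exact ⟨reduces_funLang_haltLangJump.leCt hP.1 hU', hU'.exists_add_lt hW hgap⟩
  have hlt₃ : LtCt (Kinf I') (Khalt U') := by
    obtain ⟨W, hW, hgap⟩ := exists_infLangJump_haltLangJump_gap hU'.1
    exact ⟨reduces_haltLangJump_infLangJump.leCt hU'.1 hI', hI'.exists_add_lt hW hgap⟩
  have hrefl : LeCt (KcardN P) (KcardN P) := ⟨0, fun n => by simp⟩
  rw [KChurchZ_eq]
  exact ⟨Khalt_ne_top hU, ⟨hEU, hEU, hGU⟩,
    reduces_funLang_infLang.eqCt reduces_infLang_funLang hP' hI, hQU, hRI,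
    hEU.trans hEU.symm, hEU.trans hGU.symm, hlt₁.of_leCt hrefl hEU.2,
    hlt₁.of_leCt hrefl hEU.2, hlt₁.of_leCt hrefl hGU.2, hlt₂.of_leCt hQU.1 hrefl,
    hlt₃.of_leCt hRI.1 hQU.2⟩
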